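/- Let $K$ be a field of characteristic zero and $R = K[X_1,\ldots,X_n]$, graded by $\deg X_i = \omega_i$ for positive integers $\omega_1,\ldots,\omega_n$; put $\mathfrak m = (X_1,\ldots,X_n)$. Let $f \in R$ be a nonzero polynomial which is homogeneous of positive degree for this grading, and assume that $A = R/(f)$ is an isolated singularity, i.e. the local ring $A_P$ is regular for every homogeneous prime ideal $P$ of $A$ other than $\mathfrak m A$. Let $H^1_{(f)}(R) = R_f/R$ be the first local cohomology module of $R$ with support in $(f)$, with the operators $\partial_i = \partial/\partial X_i$ induced from those on $R_f$. Write $H^i(\partial; H^1_{(f)}(R))$ for the $i$-th cohomology of the de Rham complex of $H^1_{(f)}(R)$, whose term in degree $p$ is $\bigoplus_{|I|=p} H^1_{(f)}(R)\, dX_I$, and write $H_i(\partial; H^1_{(f)}(R))$ for the $i$-th homology of the Koszul complex of $H^1_{(f)}(R)$ with respect to $\partial_1,\ldots,\partial_n$. Then, as $K$-vector spaces, $$H^i(\partial; H^1_{(f)}(R)) = 0 \quad\text{for } 0 \le i \le n-2,\ i \neq 1, \qquad\text{and}\qquad H^1(\partial; H^1_{(f)}(R)) \cong K \quad\text{if }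 n \neq 2.$$ Moreover, in homological indexing, $$H_i(\partial; H^1_{(f)}(R)) = 0 \quad\text{for } 2 \le i \le n-2 \text{ and for } i = n, \qquad\text{and}\qquad H_{n-1}(\partial; H^1_{(f)}(R)) \cong K \quad\text{if } n \neq 2.$$ -/

import Mathlib

open CategoryTheory

/-! ### The position sign -/

/-- The number of elements of `J` that are smaller than `i`. -/
def numBelow {n : ℕ} (J : Finset (Fin n)) (i : Fin n) : ℕ := (J.filter (· < i)).card

theorem numBelow_insert {n : ℕ} {J : Finset (Fin n)} {i : Fin n} (hi : i ∉ J) (k : Fin n) :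
    numBelow (insert i J) k = numBelow J k + if i < k then 1 else 0 := by
  unfold numBelow
  rw [Finset.filter_insert]
  split_ifs with h
  · rw [Finset.card_insert_of_notMem (by simp [hi])]
  · simp

theorem numBelow_sign_swap {n : ℕ} (R : Type*) [CommRing R] {J : Finset (Fin n)} {i k : Fin n}
    (hi : i ∉ J) (hk : k ∉ J) (hik : i ≠ k) :
    (-1 : R) ^ numBelow J i * (-1) ^ numBelow (insert i J) k
      + (-1 : R) ^ numBelow J k * (-1) ^ numBelow (insert k J) i = 0 := by
  rw [numBelow_insert hi, numBelow_insert hk]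
  rcases lt_or_gt_of_ne hik with h | h
  · simp only [h, h.not_gt, if_true, if_false]; ring
  · simp only [h, h.not_gt, if_true, if_false]; ring

/-! ### The de Rham complex and the Koszul complex of commuting operators -/

section Complexes

variable {K : Type*} [Field K] {M : Type*} [AddCommGroup M] [Module K M] {n : ℕ}

/-- Families `(ξ_I)` of elements of `M`, indexed by the `p`-element subsets `I` of
`{1, …, n}`: the degree `p` term `⨁_{|I| = p} M e_I` of the complexes below. -/
abbrev Forms (M : Type*) (n p : ℕ) : Type _ := {I : Finset (Fin n) // I.card = p} → M

/-- The exterior derivative of the operators `D 0, …, D (n - 1)`: the coefficient of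
`dx_I` in `d (∑ ω_J dx_J)` is `∑_{i ∈ I} ± D_i ω_{I \ {i}}`. -/
def deRhamD (D : Fin n → Module.End K M) (p : ℕ) : Forms M n p →ₗ[K] Forms M n (p + 1) where
  toFun ω I := ∑ i : {i // i ∈ I.1}, (-1 : K) ^ numBelow I.1 i.1 •
    D i.1 (ω ⟨I.1.erase i.1, by rw [Finset.card_erase_of_mem i.2, I.2]; rfl⟩)
  map_add' ω η := by
    ext I
    simp [Finset.sum_add_distrib]
  map_smul' c ω := by
    ext I
    simp [Finset.smul_sum, smul_comm c]

/-- The Koszul differential of the operators `D 0, …, D (n - 1)`: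
`(φ ξ)_J = ∑_{i ∉ J} ± D_i ξ_{J ∪ {i}}`. -/
def koszulD (D : Fin n → Module.End K M) (p : ℕ) : Forms M n (p + 1) →ₗ[K] Forms M n p where
  toFun ξ J := ∑ i : {i // i ∉ J.1}, (-1 : K) ^ numBelow J.1 i.1 •
    D i.1 (ξ ⟨insert i.1 J.1, by rw [Finset.card_insert_of_notMem i.2, J.2]⟩)
  map_add' ω η := by
    ext I
    simp [Finset.sum_add_distrib]
  map_smul' c ω := by
    ext I
    simp [Finset.smul_sum, smul_comm c]

theorem koszulD_comp (D : Fin n → Module.End K M) (hD : ∀ i j, Commute (D i) (D j)) (p : ℕ) :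
    koszulD D p ∘ₗ koszulD D (p + 1) = 0 := by
  refine LinearMap.ext fun ξ => funext fun J => ?_
  simp only [koszulD, LinearMap.comp_apply, LinearMap.coe_mk, AddHom.coe_mk, LinearMap.zero_apply,
    Pi.zero_apply, map_sum, Finset.smul_sum, map_smul]
  rw [Finset.sum_sigma']
  have hne : ∀ x : (i : {i // i ∉ J.1}) × {k // k ∉ insert i.1 J.1},
      x.1.1 ≠ x.2.1 ∧ x.2.1 ∉ J.1 := fun x => by
    have := x.2.2
    rw [Finset.mem_insert, not_or] at this
    exact ⟨fun h => this.1 h.symm, this.2⟩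
  refine Finset.sum_involution
    (fun x _ => ⟨⟨x.2.1, (hne x).2⟩, ⟨x.1.1, by
      rw [Finset.mem_insert, not_or]; exact ⟨(hne x).1, x.1.2⟩⟩⟩) ?_ ?_ ?_ ?_
  · intro x _
    have hc : ∀ m, D x.2.1 (D x.1.1 m) = D x.1.1 (D x.2.1 m) := fun m =>
      LinearMap.congr_fun (hD x.2.1 x.1.1) m
    have hs := numBelow_sign_swap K x.1.2 (hne x).2 (hne x).1
    simp only [smul_smul, hc, Finset.insert_comm x.1.1 x.2.1]
    rw [← add_smul, hs, zero_smul]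
  · intro x _ _ h
    have := congrArg (fun y => y.1.1) h
    exact (hne x).1 this.symm
  · intro x _; simp
  · intro x _; rfl

theorem deRhamD_comp (D : Fin n → Module.End K M) (hD : ∀ i j, Commute (D i) (D j)) (p : ℕ) :
    deRhamD D (p + 1) ∘ₗ deRhamD D p = 0 := by
  refine LinearMap.ext fun ω => funext fun I => ?_
  simp only [deRhamD, LinearMap.comp_apply, LinearMap.coe_mk, AddHom.coe_mk, LinearMap.zero_apply,
    Pi.zero_apply, map_sum, Finset.smul_sum, map_smul]
  rw [Finset.sum_sigma']
  have hne : ∀ x : (i : {i // i ∈ I.1}) × {k // k ∈ I.1.erase i.1},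
      x.1.1 ≠ x.2.1 ∧ x.2.1 ∈ I.1 := fun x => by
    have := x.2.2
    rw [Finset.mem_erase] at this
    exact ⟨fun h => this.1 h.symm, this.2⟩
  refine Finset.sum_involution
    (fun x _ => ⟨⟨x.2.1, (hne x).2⟩, ⟨x.1.1, by
      rw [Finset.mem_erase]; exact ⟨(hne x).1, x.1.2⟩⟩⟩) ?_ ?_ ?_ ?_
  · intro x _
    have hc : ∀ m, D x.2.1 (D x.1.1 m) = D x.1.1 (D x.2.1 m) := fun m =>
      LinearMap.congr_fun (hD x.2.1 x.1.1) m
    have h1 : insert x.2.1 ((I.1.erase x.1.1).erase x.2.1) = I.1.erase x.1.1 :=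
      Finset.insert_erase x.2.2
    have h2 : insert x.1.1 ((I.1.erase x.1.1).erase x.2.1) = I.1.erase x.2.1 := by
      rw [Finset.erase_right_comm]
      exact Finset.insert_erase (Finset.mem_erase.2 ⟨(hne x).1, x.1.2⟩)
    have n1 : x.1.1 ∉ (I.1.erase x.1.1).erase x.2.1 := by simp
    have n2 : x.2.1 ∉ (I.1.erase x.1.1).erase x.2.1 := by simp
    have a1 := numBelow_insert n1 x.1.1
    have a2 := numBelow_insert n2 x.2.1
    have a3 := numBelow_insert n1 x.2.1
    have a4 := numBelow_insert n2 x.1.1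
    have b1 := numBelow_insert (Finset.notMem_erase x.1.1 I.1) x.1.1
    have b2 := numBelow_insert (Finset.notMem_erase x.2.1 I.1) x.2.1
    rw [Finset.insert_erase x.1.2] at b1
    rw [Finset.insert_erase (hne x).2] at b2
    rw [h2] at a1 a3
    rw [h1] at a2 a4
    simp only [lt_self_iff_false, if_false, add_zero] at a1 a2 b1 b2
    have hs : (-1 : K) ^ numBelow I.1 x.1.1 * (-1) ^ numBelow (I.1.erase x.1.1) x.2.1
        + (-1 : K) ^ numBelow I.1 x.2.1 * (-1) ^ numBelow (I.1.erase x.2.1) x.1.1 = 0 := by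
      rw [b1, b2, a4, a3, a2, a1]
      rcases lt_or_gt_of_ne (hne x).1 with h | h
      · simp only [h, h.not_gt, if_true, if_false]; ring
      · simp only [h, h.not_gt, if_true, if_false]; ring
    simp only [smul_smul, hc, Finset.erase_right_comm (a := x.2.1) (b := x.1.1)]
    rw [← add_smul, hs, zero_smul]
  · intro x _ _ h
    have := congrArg (fun y => y.1.1) h
    exact (hne x).1 this.symm
  · intro x _; simp
  · intro x _; rfl

end Complexes

/-- The de Rham complex `0 → M → ⨁_i M dx_i → ⨁_{i<j} M dx_i ∧ dx_j → ⋯` of a `K`-vector space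
`M` with pairwise commuting operators `D`; its cohomology is `H^i(D; M)`. -/
noncomputable def deRhamComplex {K M : Type*} [Field K] [AddCommGroup M] [Module K M] {n : ℕ}
    (D : Fin n → Module.End K M) (hD : ∀ i j, Commute (D i) (D j)) :
    CochainComplex (ModuleCat K) ℕ :=
  CochainComplex.of (fun p => ModuleCat.of K (Forms M n p))
    (fun p => ModuleCat.ofHom (deRhamD D p))
    (fun p => by rw [← ModuleCat.ofHom_comp, deRhamD_comp D hD p]; rfl)

/-- The Koszul complex of a `K`-vector space `M` with respect to pairwise commuting operators
`D`; its homology is `H_i(D; M)`. -/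
noncomputable def koszulComplex {K M : Type*} [Field K] [AddCommGroup M] [Module K M] {n : ℕ}
    (D : Fin n → Module.End K M) (hD : ∀ i j, Commute (D i) (D j)) :
    ChainComplex (ModuleCat K) ℕ :=
  ChainComplex.of (fun p => ModuleCat.of K (Forms M n p))
    (fun p => ModuleCat.ofHom (koszulD D p))
    (fun p => by rw [← ModuleCat.ofHom_comp, koszulD_comp D hD p]; rfl)

/-! ### The partial derivatives on `R_f` and on `H¹_{(f)}(R) = R_f / R` -/

theorem derivation_eq_zero_of_localization {K R S : Type*} [CommRing K] [CommRing R] [CommRing S]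
    [Algebra K S] [Algebra R S] (M : Submonoid R) [IsLocalization M S]
    (D : Derivation K S S) (h : ∀ r : R, D (algebraMap R S r) = 0) : D = 0 := by
  ext s
  obtain ⟨⟨r, m⟩, hr⟩ := IsLocalization.surj M s
  have h1 := congrArg D hr
  rw [Derivation.leibniz, h, h, smul_zero, zero_add, smul_eq_mul] at h1
  simpa using ((IsLocalization.map_units S m).mul_right_eq_zero).1 h1

/-- A derivation `D` of `R` as a ring homomorphism `r ↦ r + D r ε` to `S[ε] / (ε²)`. -/
def derivationToDual {K R : Type*} (S : Type*) [CommRing K] [CommRing R] [CommRing S]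
    [Algebra K R] [Algebra R S] (D : Derivation K R R) :
    R →+* TrivSqZeroExt S S where
  toFun r := TrivSqZeroExt.inl (algebraMap R S r) + TrivSqZeroExt.inr (algebraMap R S (D r))
  map_one' := by simp
  map_zero' := by simp
  map_add' a b := by
    refine TrivSqZeroExt.ext ?_ ?_
    · simp
    · simp only [map_add, TrivSqZeroExt.snd_add, TrivSqZeroExt.snd_inl, TrivSqZeroExt.snd_inr,
        zero_add]
  map_mul' a b := by
    refine TrivSqZeroExt.ext ?_ ?_
    · simp
    · simp only [Derivation.leibniz, smul_eq_mul, map_add, map_mul, TrivSqZeroExt.snd_add,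
        TrivSqZeroExt.snd_inl, TrivSqZeroExt.snd_inr, TrivSqZeroExt.snd_mul,
        TrivSqZeroExt.fst_add, TrivSqZeroExt.fst_inl, TrivSqZeroExt.fst_inr, zero_add, add_zero,
        op_smul_eq_smul, smul_eq_mul]

theorem derivationToDual_isUnit {K R S : Type*} [CommRing K] [CommRing R] [CommRing S]
    [Algebra K R] [Algebra R S] (M : Submonoid R) [IsLocalization M S] (D : Derivation K R R)
    (y : M) : IsUnit (derivationToDual S D y) := by
  rw [TrivSqZeroExt.isUnit_iff_isUnit_fst]
  simpa [derivationToDual] using IsLocalization.map_units S y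

/-- The unique extension of a derivation `D` of `R` to a localization `S` of `R`
(the quotient rule), as the coefficient of `ε` in the extension of `r ↦ r + D r ε`. -/
noncomputable def locDerivation {K R : Type*} [CommRing K] [CommRing R] [Algebra K R]
    (M : Submonoid R) (S : Type*) [CommRing S] [Algebra K S] [Algebra R S] [IsScalarTower K R S]
    [IsLocalization M S] (D : Derivation K R R) : Derivation K S S :=
  let L : S →+* TrivSqZeroExt S S := IsLocalization.lift (derivationToDual_isUnit (S := S) M D)
  have hfst : ∀ s, (L s).fst = s := fun s => by
    have : (TrivSqZeroExt.fstHom S S S).toRingHom.comp L = RingHom.id S := by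
      refine IsLocalization.ringHom_ext M ?_
      ext r
      simp [L, IsLocalization.lift_eq, derivationToDual]
    exact RingHom.congr_fun this s
  have hK : ∀ c : K, (L (algebraMap K S c)).snd = 0 := fun c => by
    rw [IsScalarTower.algebraMap_apply K R S]
    simp [L, IsLocalization.lift_eq, derivationToDual]
  { toFun := fun s => (L s).snd
    map_add' := fun a b => by simp
    map_smul' := fun c s => by
      simp [Algebra.smul_def, hfst, hK]
    map_one_eq_zero' := by simp
    leibniz' := fun a b => by
      simp [hfst, mul_comm] }

theorem locDerivation_algebraMap {K R S : Type*} [CommRing K] [CommRing R] [Algebra K R]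
    [CommRing S] [Algebra K S] [Algebra R S] [IsScalarTower K R S] (M : Submonoid R)
    [IsLocalization M S] (D : Derivation K R R) (r : R) : locDerivation M S D (algebraMap R S r) = algebraMap R S (D r) := by
  change (IsLocalization.lift (derivationToDual_isUnit (S := S) M D) (algebraMap R S r)).snd = _
  simp only [IsLocalization.lift_eq, derivationToDual, RingHom.coe_mk, MonoidHom.coe_mk,
    OneHom.coe_mk, TrivSqZeroExt.snd_add, TrivSqZeroExt.snd_inl, TrivSqZeroExt.snd_inr, zero_add]

section LocalCohomology

variable {K : Type*} [Field K] {n : ℕ}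

/-- The operator `∂ᵢ = ∂/∂Xᵢ` on `R_f`, for `R = K[X_1, …, X_n]`. -/
noncomputable def partialLoc (f : MvPolynomial (Fin n) K) (i : Fin n) :
    Derivation K (Localization.Away f) (Localization.Away f) :=
  locDerivation (Submonoid.powers f) (Localization.Away f) (MvPolynomial.pderiv i)

theorem partialLoc_algebraMap (f : MvPolynomial (Fin n) K) (i : Fin n)
    (r : MvPolynomial (Fin n) K) :
    partialLoc f i (algebraMap _ (Localization.Away f) r) =
      algebraMap _ (Localization.Away f) (MvPolynomial.pderiv i r) :=
  locDerivation_algebraMap _ _ _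

theorem partialLoc_comm (f : MvPolynomial (Fin n) K) (i j : Fin n) (s : Localization.Away f) :
    partialLoc f i (partialLoc f j s) = partialLoc f j (partialLoc f i s) := by
  have h : ⁅partialLoc f i, partialLoc f j⁆ = 0 := by
    refine derivation_eq_zero_of_localization (Submonoid.powers f) _ fun r => ?_
    have hp : ⁅MvPolynomial.pderiv (R := K) i, MvPolynomial.pderiv (R := K) j⁆ = 0 := by
      refine MvPolynomial.derivation_ext fun k => ?_
      rw [Derivation.commutator_apply, MvPolynomial.pderiv_X, MvPolynomial.pderiv_X,
        Pi.single_apply, Pi.single_apply]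
      split_ifs <;> simp
    have := DFunLike.congr_fun hp r
    simp only [Derivation.commutator_apply, partialLoc_algebraMap, ← map_sub] at this ⊢
    simp [this]
  have := DFunLike.congr_fun h s
  rwa [Derivation.commutator_apply, Derivation.zero_apply, sub_eq_zero] at this

/-- The image of `R` in `R_f`, as a `K`-subspace. -/
noncomputable def imageInLoc (f : MvPolynomial (Fin n) K) : Submodule K (Localization.Away f) :=
  LinearMap.range
    (IsScalarTower.toAlgHom K (MvPolynomial (Fin n) K) (Localization.Away f)).toLinearMap

/-- The local cohomology module `H¹_{(f)}(R)` of `R = K[X_1, …, X_n]`: the first cohomology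
`R_f / R` of the Čech complex `0 → R → R_f → 0`. -/
abbrev LocalCohomologyOne (f : MvPolynomial (Fin n) K) : Type _ :=
  Localization.Away f ⧸ imageInLoc f

/-- The action of `∂ᵢ` on `H¹_{(f)}(R) = R_f / R`, induced by the one on `R_f`. -/
noncomputable def partialOp (f : MvPolynomial (Fin n) K) (i : Fin n) :
    Module.End K (LocalCohomologyOne f) :=
  (imageInLoc f).mapQ (imageInLoc f) (partialLoc f i).toLinearMap (by
    rintro _ ⟨r, rfl⟩
    exact ⟨MvPolynomial.pderiv i r, (partialLoc_algebraMap f i r).symm⟩)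

theorem partialOp_commute (f : MvPolynomial (Fin n) K) (i j : Fin n) :
    Commute (partialOp f i) (partialOp f j) := by
  refine LinearMap.ext fun x => ?_
  obtain ⟨s, rfl⟩ := Submodule.Quotient.mk_surjective _ x
  exact congrArg (Submodule.Quotient.mk (p := imageInLoc f)) (partialLoc_comm f i j s)

/-- The de Rham cohomology `H^i(∂; H¹_{(f)}(R))`. -/
noncomputable def deRhamCohomology (f : MvPolynomial (Fin n) K) (i : ℕ) : ModuleCat K :=
  (deRhamComplex (partialOp f) (partialOp_commute f)).homology i

/-- The de Rham homology `H_i(∂; H¹_{(f)}(R))`: Koszul homology with respect to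
`∂_1, …, ∂_n`. -/
noncomputable def deRhamHomology (f : MvPolynomial (Fin n) K) (i : ℕ) : ModuleCat K :=
  (koszulComplex (partialOp f) (partialOp_commute f)).homology i

/-- `A = R / (f)` is an isolated singularity, for the grading `deg X_i = w i` of
`R = K[X_1, …, X_n]`: the local ring `A_P` is regular for every homogeneous prime ideal `P` of `A`
other than the one generated by `X_1, …, X_n`. A prime of `A` is homogeneous if and only if
its preimage in `R` is. -/
def IsIsolatedSingularity (w : Fin n → ℕ) (f : MvPolynomial (Fin n) K) : Prop :=
  letI := MvPolynomial.weightedGradedAlgebra K w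
  ∀ (P : Ideal (MvPolynomial (Fin n) K ⧸ Ideal.span {f})) [P.IsPrime],
    (P.comap (Ideal.Quotient.mk (Ideal.span {f}))).IsHomogeneous
      (MvPolynomial.weightedHomogeneousSubmodule K w) →
    P.comap (Ideal.Quotient.mk (Ideal.span {f})) ≠ Ideal.span (Set.range MvPolynomial.X) →
    IsRegularLocalRing (Localization.AtPrime P)

end LocalCohomology

/-! The groups in question are compared with the algebraic de Rham cohomology of the open set `f ≠
0`. The de Rham complex of `R` is acyclic in positive degrees (`poincare_lemma`), so a closed form
over `R_f / R` lifts to a closed form over `R_f` (`exists_closed_lift`), and it suffices to study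
closed forms `α / f ^ k`.

Isolatedness enters through the Jacobian criterion: a homogeneous prime containing all partial
derivatives of `f` gives a non-regular point of `A`, hence is the irrelevant ideal. So the Jacobian
ideal contains powers of the variables, which form a regular sequence of length `n`, and the Koszul
complex of the partial derivatives is exact below degree `n` (`IsIsolatedSingularity.koszul_exact`).

This exactness lowers the pole order, as in Griffiths' reduction. If `α / f ^ k` is closed of degree
at most `n - 2`, then `k α = f β + df ∧ γ`, and for `k ≥ 2` the term `df ∧ γ / f ^ k` has pole order
`k - 1` up to an exact form. What remains is `β + (df / f) ∧ γ` with `β` and `γ` polynomial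
(`KoszulExact.exists_logarithmic`).

The grading finishes the computation. By Cartan's formula the Lie derivative along the Euler field
is homotopic to zero and multiplies a form by its weight, so only weight zero contributes
cohomology. All `w i` are positive and `df / f` has weight zero, so in positive degree weight zero
occurs only for a constant `γ`: nothing is left in degrees from `2` to `n - 2`, and multiples of `df
/ f` in degree one. The class of `df / f` is not zero: contraction with the Euler field gives the
constant `d`, which no element of `R_f` has as its Euler derivative (`logForm_ne_extOp_add`). Degree
zero is a statement about reduced fractions, and `n = 1` is a direct computation with monomials. The
Koszul complex is the de Rham complex read through a star operator, with `q` and `n - q` exchanged.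
-/

/-! ### The Jacobian criterion for hypersurfaces. -/

section Jacobian

open IsLocalRing

/-- Taylor's formula of order one, for two homomorphisms that differ by elements of square zero. -/
theorem MvPolynomial.algHom_eq_add_sum_pderiv {K B σ : Type*} [CommRing K] [CommRing B]
    [Algebra K B] [Fintype σ] [DecidableEq σ] (φ ψ : MvPolynomial σ K →ₐ[K] B) (t : σ → B)
    (h : ∀ i, φ (X i) = ψ (X i) + t i) (ht : ∀ i j, t i * t j = 0) (p : MvPolynomial σ K) :
    φ p = ψ p + ∑ i, ψ (pderiv i p) * t i := by
  induction p using MvPolynomial.induction_on with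
  | C a => simp [← MvPolynomial.algebraMap_eq]
  | add p q hp hq =>
    simp only [map_add, hp, hq, add_mul, Finset.sum_add_distrib]
    ring
  | mul_X p j hp =>
    have h1 : (∑ i, ψ (pderiv i p) * t i) * t j = 0 := by
      rw [Finset.sum_mul]
      exact Finset.sum_eq_zero fun i _ => by rw [mul_assoc, ht, mul_zero]
    have h2 : ∑ i, ψ (pderiv i (p * X j)) * t i =
        ψ p * t j + (∑ i, ψ (pderiv i p) * t i) * ψ (X j) := by
      simp only [Derivation.leibniz, smul_eq_mul, map_add, map_mul, add_mul,
        Finset.sum_add_distrib, pderiv_X, Finset.sum_mul]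
      congr 1
      · rw [Finset.sum_eq_single j]
        · simp
        · intro i _ hi
          simp [hi.symm]
        · simp
      · exact Finset.sum_congr rfl fun i _ => by ring
    rw [map_mul, map_mul, hp, h, h2]
    linear_combination h1

/-- A polynomial over a field of characteristic zero vanishes at a point of a square-zero
extension of a field if it vanishes in the field together with its partial derivatives. -/
theorem MvPolynomial.algHom_eq_zero_of_pderiv {K σ B L : Type*} [Field K] [CharZero K]
    [Fintype σ] [DecidableEq σ] [CommRing B] [Algebra K B] [Field L] [Algebra K L]
    [Algebra.EssFiniteType K L]
    (g : B →ₐ[K] L) (hg : Function.Surjective g) (hker : ∀ x y, g x = 0 → g y = 0 → x * y = 0)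
    (φ : MvPolynomial σ K →ₐ[K] B) (f : MvPolynomial σ K) (hf : g (φ f) = 0)
    (hd : ∀ i, g (φ (pderiv i f)) = 0) : φ f = 0 := by
  have hnil : IsNilpotent (RingHom.ker (g : B →+* L)) := by
    refine ⟨2, ?_⟩
    rw [pow_two, Ideal.zero_eq_bot, eq_bot_iff, Ideal.mul_le]
    intro x hx y hy
    exact hker x y hx hy
  -- Over a perfect field `L` is formally smooth, so the square-zero extension `g` has a section
  -- `τ`, a coefficient field in `B`.
  have : Algebra.FormallySmooth K L := Algebra.FormallySmooth.of_perfectField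
  let τ : L →ₐ[K] B :=
    Algebra.FormallySmooth.liftOfSurjective (AlgHom.id K L) g hg hnil
  have hτ : ∀ x, g (τ x) = x := fun x =>
    Algebra.FormallySmooth.liftOfSurjective_apply (AlgHom.id K L) g hg hnil x
  -- Expand `f` at the point `τ ∘ g ∘ φ`. It differs from `φ` by elements of `ker g`, and both `f`
  -- and its partial derivatives vanish there.
  have key := MvPolynomial.algHom_eq_add_sum_pderiv φ ((τ.comp g).comp φ)
    (fun i => φ (X i) - τ (g (φ (X i)))) (fun i => by simp)
    (fun i j => hker _ _ (by rw [map_sub, hτ]; exact sub_self _)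
      (by rw [map_sub, hτ]; exact sub_self _)) f
  simpa only [AlgHom.comp_apply, hf, hd, map_zero, zero_mul,
    Finset.sum_const_zero, add_zero] using key

/-- In characteristic zero, a polynomial that vanishes at a point of a local ring modulo the
maximal ideal, together with its partial derivatives, vanishes modulo its square. -/
theorem MvPolynomial.algHom_mem_maximalIdeal_sq {K σ S : Type*} [Field K] [CharZero K]
    [Fintype σ] [DecidableEq σ] [CommRing S] [IsLocalRing S] [Algebra K S]
    [Algebra.EssFiniteType K S]
    (φ : MvPolynomial σ K →ₐ[K] S) (f : MvPolynomial σ K) (hf : φ f ∈ maximalIdeal S)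
    (hd : ∀ i, φ (pderiv i f) ∈ maximalIdeal S) : φ f ∈ maximalIdeal S ^ 2 := by
  let g : S ⧸ maximalIdeal S ^ 2 →ₐ[K] S ⧸ maximalIdeal S :=
    Ideal.Quotient.factorₐ K (Ideal.pow_le_self two_ne_zero)
  have hg : Function.Surjective g := fun x => by
    obtain ⟨s, rfl⟩ := Ideal.Quotient.mk_surjective x
    exact ⟨Ideal.Quotient.mk _ s, rfl⟩
  have hgmk : ∀ s : S, g (Ideal.Quotient.mkₐ K _ s) = Ideal.Quotient.mk _ s := fun s => rfl
  have hker : ∀ x y, g x = 0 → g y = 0 → x * y = 0 := by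
    intro x y hx hy
    obtain ⟨s, rfl⟩ := Ideal.Quotient.mkₐ_surjective K _ x
    obtain ⟨t, rfl⟩ := Ideal.Quotient.mkₐ_surjective K _ y
    rw [hgmk, Ideal.Quotient.eq_zero_iff_mem] at hx hy
    rw [← map_mul]
    exact Ideal.Quotient.eq_zero_iff_mem.2 (pow_two (maximalIdeal S) ▸ Ideal.mul_mem_mul hx hy)
  have : Algebra.EssFiniteType K (S ⧸ maximalIdeal S) := Algebra.EssFiniteType.comp K S _
  let : Field (S ⧸ maximalIdeal S) := Ideal.Quotient.field _
  have key := MvPolynomial.algHom_eq_zero_of_pderiv g hg hker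
    ((Ideal.Quotient.mkₐ K (maximalIdeal S ^ 2)).comp φ) f
    (Ideal.Quotient.eq_zero_iff_mem.2 hf) (fun i => Ideal.Quotient.eq_zero_iff_mem.2 (hd i))
  exact Ideal.Quotient.eq_zero_iff_mem.1 key

/-- A noetherian local domain is not regular modulo a nonzero element of the square of its
maximal ideal. -/
theorem not_isRegularLocalRing_of_mem_maximalIdeal_sq {S T : Type*} [CommRing S] [CommRing T]
    [IsDomain S] [IsLocalRing S] [IsNoetherianRing S] (φ : S →+* T)
    (hφ : Function.Surjective φ) (x : S) (hx : x ≠ 0) (hx2 : x ∈ maximalIdeal S ^ 2)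
    (hker : RingHom.ker φ = Ideal.span {x}) : ¬ IsRegularLocalRing T := by
  intro hT
  have hxm : x ∈ maximalIdeal S := Ideal.pow_le_self two_ne_zero hx2
  -- Dividing by `x` lowers the dimension, but not the number of generators of the maximal ideal
  -- because `x` lies in its square.
  have hdim : ringKrullDim T + 1 ≤ ringKrullDim S := by
    rw [← ringKrullDim_eq_of_ringEquiv (RingHom.quotientKerEquivOfSurjective hφ), hker]
    exact ringKrullDim_quotient_succ_le_of_nonZeroDivisor
      (mem_nonZeroDivisors_of_ne_zero hx)
  have := IsLocalHom.of_surjective φ hφ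
  have hmap : ∀ s, φ s ∈ maximalIdeal T ↔ s ∈ maximalIdeal S := fun s => by
    simp [mem_maximalIdeal, mem_nonunits_iff]
  obtain ⟨s, hs, hspan⟩ := Submodule.FG.exists_span_finset_card_eq_spanFinrank
    (maximalIdeal T).fg_of_isNoetherianRing
  classical
  let r : T → S := Function.surjInv hφ
  have hr : ∀ t, φ (r t) = t := Function.surjInv_eq hφ
  -- Nakayama: lifts of generators of the maximal ideal of `T` generate that of `S` modulo `x`,
  -- hence modulo its square.
  have hle : maximalIdeal S ≤ Ideal.span (s.image r : Set S) := by
    refine Submodule.le_of_le_smul_of_le_jacobson_bot (I := maximalIdeal S)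
      (maximalIdeal S).fg_of_isNoetherianRing (maximalIdeal_le_jacobson ⊥) fun a ha => ?_
    have h1 : φ a ∈ (Ideal.span (s.image r : Set S)).map φ := by
      have h2 : (φ '' (s.image r : Set S)) = s := by
        rw [Finset.coe_image, Set.image_image]
        simp [hr]
      rw [Ideal.map_span, h2]
      have h4 := (hmap a).2 ha
      rwa [← hspan] at h4
    obtain ⟨b, hb, hba⟩ := (Ideal.mem_map_iff_of_surjective φ hφ).1 h1
    have h3 : a - b ∈ Ideal.span {x} := by
      rw [← hker, RingHom.mem_ker, map_sub, hba, sub_self]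
    rw [← add_sub_cancel b a]
    refine Submodule.add_mem_sup hb ?_
    rw [smul_eq_mul, ← pow_two]
    exact (Ideal.span_singleton_le_iff_mem _).2 hx2 h3
  have heq : maximalIdeal S = Ideal.span (s.image r : Set S) := by
    refine le_antisymm hle (Ideal.span_le.2 ?_)
    intro a ha
    obtain ⟨t, ht, rfl⟩ := Finset.mem_image.1 (Finset.mem_coe.1 ha)
    refine (hmap _).1 ?_
    rw [hr, ← hspan]
    exact Ideal.subset_span ht
  have hcard : (maximalIdeal S).spanFinrank ≤ (maximalIdeal T).spanFinrank := by
    rw [heq, ← hs]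
    refine (Submodule.spanFinrank_span_le_ncard_of_finite (Finset.finite_toSet _)).trans ?_
    rw [Set.ncard_coe_finset]
    exact Finset.card_image_le
  have h4 := ringKrullDim_le_spanFinrank_maximalIdeal S
  have h5 := hT.spanFinrank_maximalIdeal
  rw [← h5] at hdim
  have h6 := hdim.trans h4
  have h7 : (maximalIdeal T).spanFinrank + 1 ≤ (maximalIdeal S).spanFinrank := by
    exact_mod_cast h6
  omega

/-- The Jacobian criterion: a hypersurface over a field of characteristic zero is not regular at
a prime that contains the partial derivatives of its equation. -/
theorem MvPolynomial.not_isRegularLocalRing_of_pderiv_mem {K σ : Type*} [Field K] [CharZero K]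
    [Finite σ] (f : MvPolynomial σ K) (hf0 : f ≠ 0)
    (P : Ideal (MvPolynomial σ K ⧸ Ideal.span {f})) [P.IsPrime]
    (hd : ∀ i, pderiv i f ∈ P.comap (Ideal.Quotient.mk (Ideal.span {f}))) :
    ¬ IsRegularLocalRing (Localization.AtPrime P) := by
  classical
  have := Fintype.ofFinite σ
  set q := Ideal.Quotient.mk (Ideal.span {f})
  have hq : Function.Surjective q := Ideal.Quotient.mk_surjective
  set Q := P.comap q with hQ
  have hfQ : f ∈ Q := by
    rw [hQ, Ideal.mem_comap, Ideal.Quotient.eq_zero_iff_mem.2 (Ideal.mem_span_singleton_self f)]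
    exact P.zero_mem
  have hM : Q.primeCompl.map q = P.primeCompl := by
    ext y
    constructor
    · rintro ⟨x, hx, rfl⟩
      exact hx
    · intro hy
      obtain ⟨x, rfl⟩ := hq y
      exact ⟨x, hy, rfl⟩
  let φ := Localization.localRingHom Q P q hQ
  have hloc : IsLocalization (Q.primeCompl.map q) (Localization.AtPrime P) := by
    rw [hM]
    infer_instance
  have hφ : Function.Surjective φ :=
    IsLocalization.map_surjective_of_surjective Q.primeCompl (Localization.AtPrime Q)
      (Localization.AtPrime P) hq
  have hker : RingHom.ker φ = Ideal.span {algebraMap _ (Localization.AtPrime Q) f} := by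
    have h := IsLocalization.ker_map (S := Localization.AtPrime Q) (Localization.AtPrime P) q hM
    rw [Ideal.mk_ker, Ideal.map_span, Set.image_singleton] at h
    exact h
  have hess : Algebra.EssFiniteType K (Localization.AtPrime Q) :=
    Algebra.EssFiniteType.comp K (MvPolynomial σ K) _
  have hmem : ∀ p, p ∈ Q → algebraMap _ (Localization.AtPrime Q) p ∈
      maximalIdeal (Localization.AtPrime Q) := fun p hp =>
    (IsLocalization.AtPrime.to_map_mem_maximal_iff _ Q p).2 hp
  refine not_isRegularLocalRing_of_mem_maximalIdeal_sq φ hφ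
    (algebraMap _ (Localization.AtPrime Q) f) ?_ ?_ hker
  · intro h
    exact hf0 (IsLocalization.injective (Localization.AtPrime Q)
      Q.primeCompl_le_nonZeroDivisors (h.trans (map_zero _).symm))
  · exact MvPolynomial.algHom_mem_maximalIdeal_sq
      (IsScalarTower.toAlgHom K (MvPolynomial σ K) (Localization.AtPrime Q)) f (hmem _ hfQ)
      (fun i => hmem _ (hd i))

end Jacobian

/-! ### The Jacobian ideal of an isolated singularity. -/

section IsolatedSingularity

variable {K : Type*} [Field K] {n : ℕ}

/-- The Jacobian ideal of `f`, generated by its partial derivatives. -/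
noncomputable def jacobianIdeal (f : MvPolynomial (Fin n) K) : Ideal (MvPolynomial (Fin n) K) :=
  Ideal.span (Set.range fun i => MvPolynomial.pderiv i f)

/-- Euler's identity `∑ w i X_i ∂_i f = d f`, with `d` invertible in characteristic zero. -/
theorem MvPolynomial.IsWeightedHomogeneous.mem_jacobianIdeal [CharZero K] {w : Fin n → ℕ}
    {f : MvPolynomial (Fin n) K} {d : ℕ} (hd : 0 < d) (hf : IsWeightedHomogeneous w f d) :
    f ∈ jacobianIdeal f := by
  have h : ∑ i : Fin n, w i • (X i * pderiv i f) ∈ jacobianIdeal f :=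
    Ideal.sum_mem _ fun i _ => (jacobianIdeal f).nsmul_mem
      (Ideal.mul_mem_left _ _ (Ideal.subset_span ⟨i, rfl⟩)) _
  rw [hf.sum_weight_X_mul_pderiv, nsmul_eq_mul, ← map_natCast (C : K →+* _)] at h
  have h2 := Ideal.mul_mem_left _ (C (d : K)⁻¹) h
  rwa [← mul_assoc, ← map_mul, inv_mul_cancel₀ (Nat.cast_ne_zero.2 hd.ne'), map_one,
    one_mul] at h2

/-- The expected degree `d - w i` is meaningful only for `w i ≤ d`; otherwise `X_i` does not occur
in `f` and the derivative is zero. -/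
theorem MvPolynomial.IsWeightedHomogeneous.pderiv_exists {w : Fin n → ℕ}
    {f : MvPolynomial (Fin n) K} {d : ℕ} (hf : IsWeightedHomogeneous w f d) (i : Fin n) :
    ∃ m, IsWeightedHomogeneous w (pderiv i f) m := by
  by_cases h : w i ≤ d
  · exact ⟨d - w i, hf.pderiv (Nat.sub_add_cancel h)⟩
  · refine ⟨0, ?_⟩
    rw [pderiv_eq_zero_of_notMem_vars]
    · exact isWeightedHomogeneous_zero K w 0
    · intro hi
      obtain ⟨s, hs, his⟩ := (mem_vars_iff_mem_support i).1 hi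
      have h1 := hf (mem_support_iff.1 hs)
      have h2 := Finsupp.le_weight_of_ne_zero' w (Finsupp.mem_support_iff.1 his)
      omega

/-- The Jacobian ideal of an isolated singularity contains powers of the variables. -/
theorem IsIsolatedSingularity.X_mem_radical [CharZero K] {w : Fin n → ℕ}
    {f : MvPolynomial (Fin n) K} (hf0 : f ≠ 0) {d : ℕ} (hd : 0 < d)
    (hf : MvPolynomial.IsWeightedHomogeneous w f d) (hiso : IsIsolatedSingularity w f)
    (i : Fin n) : MvPolynomial.X i ∈ (jacobianIdeal f).radical := by
  let _ := MvPolynomial.weightedGradedAlgebra K w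
  rw [Ideal.radical_eq_sInf, Ideal.mem_sInf]
  rintro Q ⟨hJQ, hQ⟩
  -- The hypothesis concerns homogeneous primes only. The homogeneous core of `Q` is prime and still
  -- contains the partial derivatives, since these are homogeneous.
  set P := (Q.homogeneousCore (MvPolynomial.weightedHomogeneousSubmodule K w)).toIdeal with hP
  have hPprime : P.IsPrime := hQ.homogeneousCore
  have hPhom := (Q.homogeneousCore (MvPolynomial.weightedHomogeneousSubmodule K w)).isHomogeneous
  have hPQ : P ≤ Q := Ideal.toIdeal_homogeneousCore_le _ Q
  have hdP : ∀ i, MvPolynomial.pderiv i f ∈ P := fun i => by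
    obtain ⟨m, hm⟩ := hf.pderiv_exists i
    exact Ideal.mem_homogeneousCore_of_homogeneous_of_mem ⟨m, hm⟩
      (hJQ (Ideal.subset_span ⟨i, rfl⟩))
  have hJP : jacobianIdeal f ≤ P := Ideal.span_le.2 (by rintro _ ⟨i, rfl⟩; exact hdP i)
  have hfP : Ideal.span {f} ≤ P :=
    (Ideal.span_singleton_le_iff_mem _).2 (hJP (hf.mem_jacobianIdeal hd))
  have hcomap : (P.map (Ideal.Quotient.mk (Ideal.span {f}))).comap
      (Ideal.Quotient.mk (Ideal.span {f})) = P := Ideal.comap_map_mk hfP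
  have hprime : (P.map (Ideal.Quotient.mk (Ideal.span {f}))).IsPrime :=
    Ideal.map_isPrime_of_surjective Ideal.Quotient.mk_surjective (by rwa [Ideal.mk_ker])
  have hreg := hiso (P.map (Ideal.Quotient.mk (Ideal.span {f}))) (by rw [hcomap]; exact hPhom)
  rw [hcomap] at hreg
  -- If `X i ∉ Q`, then `P ⊆ Q` is not the irrelevant ideal, so `A` is regular at `P`, against the
  -- Jacobian criterion.
  by_contra hX
  refine MvPolynomial.not_isRegularLocalRing_of_pderiv_mem f hf0 _ (by rwa [hcomap])
    (hreg fun h => hX (hPQ ?_))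
  rw [h]
  exact Ideal.subset_span ⟨i, rfl⟩

end IsolatedSingularity

/-! ### Exterior calculus on forms of all degrees at once. -/

section TotalForms

variable {n : ℕ} {M N : Type*} [AddCommGroup M] [AddCommGroup N]

theorem numBelow_erase {J : Finset (Fin n)} {i : Fin n} (hi : i ∈ J) (k : Fin n) :
    numBelow J k = numBelow (J.erase i) k + if i < k then 1 else 0 := by
  conv_lhs => rw [← Finset.insert_erase hi]
  exact numBelow_insert (Finset.notMem_erase i J) k

/-- Exterior multiplication by `dx_i` on families indexed by all subsets. -/
def wedge (M : Type*) [AddCommGroup M] (i : Fin n) :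
    (Finset (Fin n) → M) →+ (Finset (Fin n) → M) where
  toFun ω I := if i ∈ I then (-1 : ℤ) ^ numBelow I i • ω (I.erase i) else 0
  map_zero' := by ext I; simp
  map_add' ω η := by ext I; dsimp; split_ifs <;> simp

/-- Contraction with `∂_i` on families indexed by all subsets. -/
def contract (M : Type*) [AddCommGroup M] (i : Fin n) :
    (Finset (Fin n) → M) →+ (Finset (Fin n) → M) where
  toFun ω J := if i ∈ J then 0 else (-1 : ℤ) ^ numBelow J i • ω (insert i J)
  map_zero' := by ext I; simp
  map_add' ω η := by ext I; dsimp; split_ifs <;> simp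

theorem wedge_apply (i : Fin n) (ω : Finset (Fin n) → M) (I : Finset (Fin n)) :
    wedge M i ω I = if i ∈ I then (-1 : ℤ) ^ numBelow I i • ω (I.erase i) else 0 := rfl

theorem contract_apply (i : Fin n) (ω : Finset (Fin n) → M) (I : Finset (Fin n)) :
    contract M i ω I = if i ∈ I then 0 else (-1 : ℤ) ^ numBelow I i • ω (insert i I) := rfl

theorem wedge_comp (g : M →+ N) (i : Fin n) (ω : Finset (Fin n) → M) :
    wedge N i (g ∘ ω) = g ∘ wedge M i ω := by
  ext I
  simp only [wedge_apply, Function.comp_apply]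
  split_ifs <;> simp

theorem contract_comp (g : M →+ N) (i : Fin n) (ω : Finset (Fin n) → M) :
    contract N i (g ∘ ω) = g ∘ contract M i ω := by
  ext I
  simp only [contract_apply, Function.comp_apply]
  split_ifs <;> simp

theorem wedge_wedge (i j : Fin n) (ω : Finset (Fin n) → M) :
    wedge M i (wedge M j ω) = -wedge M j (wedge M i ω) := by
  ext I
  rcases eq_or_ne i j with rfl | hij
  · simp [wedge_apply]
  · simp only [wedge_apply, Pi.neg_apply, Finset.mem_erase]
    by_cases hi : i ∈ I
    · by_cases hj : j ∈ I
      · rw [if_pos hi, if_pos ⟨hij.symm, hj⟩, if_pos hj, if_pos ⟨hij, hi⟩, smul_smul, smul_smul,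
          ← neg_smul, Finset.erase_right_comm, numBelow_erase hi j, numBelow_erase hj i]
        congr 1
        rcases lt_or_gt_of_ne hij with h | h
        · simp only [h, h.not_gt, if_true, if_false]; ring
        · simp only [h, h.not_gt, if_true, if_false]; ring
      · simp [hj]
    · simp [hi]

/-- The canonical anticommutation relation, from which both the Koszul homotopy and Cartan's formula
are derived. -/
theorem contract_wedge (i j : Fin n) (ω : Finset (Fin n) → M) :
    contract M i (wedge M j ω) + wedge M j (contract M i ω) = if i = j then ω else 0 := by
  ext I
  rcases eq_or_ne i j with rfl | hij
  · simp only [wedge_apply, contract_apply, Pi.add_apply, if_true]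
    by_cases hi : i ∈ I
    · have h := numBelow_erase hi i
      rw [if_neg (lt_irrefl i), add_zero] at h
      simp [hi, smul_smul, h, ← mul_pow]
    · have h := numBelow_insert hi i
      rw [if_neg (lt_irrefl i), add_zero] at h
      simp [hi, smul_smul, h, ← mul_pow]
  · simp only [wedge_apply, contract_apply, Pi.add_apply, if_neg hij, Pi.zero_apply]
    by_cases hj : j ∈ I
    · by_cases hi : i ∈ I
      · simp [hi, hij]
      · rw [if_neg hi, if_pos (Finset.mem_insert_of_mem hj), if_pos hj,
          if_neg (fun h => hi (Finset.mem_of_mem_erase h)), Finset.erase_insert_of_ne hij,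
          smul_smul, smul_smul, ← add_smul, numBelow_insert hi j, numBelow_erase hj i]
        rcases lt_or_gt_of_ne hij with h | h
        · simp only [h, h.not_gt, if_true, if_false]; ring_nf; simp
        · simp only [h, h.not_gt, if_true, if_false]; ring_nf; simp
    · simp [hj, hij.symm]

theorem wedge_contract_self (i : Fin n) (ω : Finset (Fin n) → M) (I : Finset (Fin n)) :
    wedge M i (contract M i ω) I = if i ∈ I then ω I else 0 := by
  have h := congrFun (contract_wedge i i ω) I
  by_cases hi : i ∈ I
  · simpa [contract_apply, hi] using h
  · simp [wedge_apply, hi]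

/-- The operator `∑ dx_i ∧ φ_i`. -/
def extOp (φ : Fin n → M →+ N) : (Finset (Fin n) → M) →+ (Finset (Fin n) → N) where
  toFun ω := ∑ i, wedge N i (φ i ∘ ω)
  map_zero' := by
    refine Finset.sum_eq_zero fun i _ => ?_
    rw [wedge_comp, map_zero]
    ext I
    simp
  map_add' ω η := by
    simp only [wedge_comp, map_add, ← Finset.sum_add_distrib]
    refine Finset.sum_congr rfl fun i _ => ?_
    ext I
    simp

/-- The operator `∑ φ_i ∘ ι_i`, where `ι_i` is the contraction with `∂_i`. -/
def intOp (φ : Fin n → M →+ N) : (Finset (Fin n) → M) →+ (Finset (Fin n) → N) where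
  toFun ω := ∑ i, contract N i (φ i ∘ ω)
  map_zero' := by
    refine Finset.sum_eq_zero fun i _ => ?_
    rw [contract_comp, map_zero]
    ext I
    simp
  map_add' ω η := by
    simp only [contract_comp, map_add, ← Finset.sum_add_distrib]
    refine Finset.sum_congr rfl fun i _ => ?_
    ext I
    simp

theorem extOp_def (φ : Fin n → M →+ N) (ω : Finset (Fin n) → M) :
    extOp φ ω = ∑ i, wedge N i (φ i ∘ ω) := rfl

theorem intOp_def (φ : Fin n → M →+ N) (ω : Finset (Fin n) → M) :
    intOp φ ω = ∑ i, contract N i (φ i ∘ ω) := rfl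

theorem extOp_apply (φ : Fin n → M →+ N) (ω : Finset (Fin n) → M) (I : Finset (Fin n)) :
    extOp φ ω I = ∑ i, if i ∈ I then (-1 : ℤ) ^ numBelow I i • φ i (ω (I.erase i)) else 0 := by
  simp [extOp_def, wedge_apply]

theorem intOp_apply (φ : Fin n → M →+ N) (ω : Finset (Fin n) → M) (I : Finset (Fin n)) :
    intOp φ ω I = ∑ i, if i ∈ I then 0 else (-1 : ℤ) ^ numBelow I i • φ i (ω (insert i I)) := by
  simp [intOp_def, contract_apply]

attribute [irreducible] wedge contract extOp intOp

/-- Naturality of `extOp`. -/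
theorem extOp_comp {M' N' : Type*} [AddCommGroup M'] [AddCommGroup N'] (φ : Fin n → M →+ N)
    (φ' : Fin n → M' →+ N') (g : M →+ M') (h : N →+ N') (hgh : ∀ i x, φ' i (g x) = h (φ i x))
    (ω : Finset (Fin n) → M) : extOp φ' (g ∘ ω) = h ∘ extOp φ ω := by
  ext I
  simp only [extOp_apply, Function.comp_apply, map_sum, apply_ite h, map_zsmul, map_zero, hgh]

theorem extOp_extOp {P : Type*} [AddCommGroup P] (φ : Fin n → M →+ N) (ψ : Fin n → N →+ P)
    (ω : Finset (Fin n) → M) :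
    extOp ψ (extOp φ ω) = ∑ i, ∑ j, wedge P i (wedge P j (ψ i ∘ φ j ∘ ω)) := by
  simp only [extOp_def]
  refine Finset.sum_congr rfl fun i _ => ?_
  rw [← map_sum]
  congr 1
  ext I
  simp only [Function.comp_apply, Finset.sum_apply, map_sum]
  refine Finset.sum_congr rfl fun j _ => ?_
  exact (congrFun (wedge_comp (ψ i) j (φ j ∘ ω)) I).symm

/-- Exchange the two summation indices; the `dx_i` anticommute while the coefficient operators
commute in the sense of `h`. -/
theorem extOp_extOp_eq_neg {N' P : Type*} [AddCommGroup N'] [AddCommGroup P] (φ : Fin n → M →+ N)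
    (ψ : Fin n → N →+ P) (φ' : Fin n → M →+ N') (ψ' : Fin n → N' →+ P)
    (h : ∀ i j x, ψ i (φ j x) = ψ' j (φ' i x)) (ω : Finset (Fin n) → M) :
    extOp ψ (extOp φ ω) = -extOp ψ' (extOp φ' ω) := by
  rw [extOp_extOp, extOp_extOp, Finset.sum_comm, ← Finset.sum_neg_distrib]
  refine Finset.sum_congr rfl fun i _ => ?_
  rw [← Finset.sum_neg_distrib]
  refine Finset.sum_congr rfl fun j _ => ?_
  rw [wedge_wedge]
  congr 3
  ext I
  exact h j i _

/-- The square equals its own negative, so the absence of torsion makes it vanish. -/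
theorem extOp_extOp_self [IsAddTorsionFree M] (φ : Fin n → M →+ M)
    (h : ∀ i j x, φ i (φ j x) = φ j (φ i x)) (ω : Finset (Fin n) → M) :
    extOp φ (extOp φ ω) = 0 :=
  self_eq_neg.1 (extOp_extOp_eq_neg φ φ φ φ h ω)

/-- The graded commutator of `∑ dx_i ∧ φ_i` and `∑ ψ_j ∘ ι_j`. -/
theorem extOp_intOp_add (φ ψ : Fin n → M →+ M) (ω : Finset (Fin n) → M) :
    extOp φ (intOp ψ ω) + intOp ψ (extOp φ ω) =
      (∑ i, ψ i ∘ φ i ∘ ω) +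
        ∑ i, ∑ j, wedge M i (contract M j (fun I => φ i (ψ j (ω I)) - ψ j (φ i (ω I)))) := by
  have h1 : extOp φ (intOp ψ ω) = ∑ i, ∑ j, wedge M i (contract M j (φ i ∘ ψ j ∘ ω)) := by
    simp only [extOp_def, intOp_def]
    refine Finset.sum_congr rfl fun i _ => ?_
    rw [← map_sum]
    congr 1
    ext I
    simp only [Function.comp_apply, Finset.sum_apply, map_sum]
    refine Finset.sum_congr rfl fun j _ => ?_
    exact (congrFun (contract_comp (φ i) j (ψ j ∘ ω)) I).symm
  have h2 : intOp ψ (extOp φ ω) = ∑ i, ∑ j, contract M j (wedge M i (ψ j ∘ φ i ∘ ω)) := by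
    rw [Finset.sum_comm]
    simp only [extOp_def, intOp_def]
    refine Finset.sum_congr rfl fun i _ => ?_
    rw [← map_sum]
    congr 1
    ext I
    simp only [Function.comp_apply, Finset.sum_apply, map_sum]
    refine Finset.sum_congr rfl fun j _ => ?_
    exact (congrFun (wedge_comp (ψ i) j (φ j ∘ ω)) I).symm
  have h3 : ∀ i j, wedge M i (contract M j (φ i ∘ ψ j ∘ ω)) +
      contract M j (wedge M i (ψ j ∘ φ i ∘ ω)) =
      (if j = i then ψ j ∘ φ i ∘ ω else 0) +
      wedge M i (contract M j (fun I => φ i (ψ j (ω I)) - ψ j (φ i (ω I)))) := fun i j => by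
    rw [← contract_wedge]
    have : (fun I => φ i (ψ j (ω I)) - ψ j (φ i (ω I))) = φ i ∘ ψ j ∘ ω - ψ j ∘ φ i ∘ ω := rfl
    rw [this, map_sub, map_sub]
    abel
  rw [h1, h2, ← Finset.sum_add_distrib]
  simp only [← Finset.sum_add_distrib, h3]
  simp only [Finset.sum_add_distrib, Finset.sum_ite_eq', Finset.mem_univ, if_true]

/-- The part of degree `p` of a family. -/
def degPart (p : ℕ) (ω : Finset (Fin n) → M) : Finset (Fin n) → M :=
  fun I => if I.card = p then ω I else 0

theorem extOp_degPart (φ : Fin n → M →+ N) (p : ℕ) (ω : Finset (Fin n) → M) :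
    extOp φ (degPart p ω) = degPart (p + 1) (extOp φ ω) := by
  ext I
  simp only [extOp_apply, degPart]
  split_ifs with h
  · refine Finset.sum_congr rfl fun i _ => ?_
    split_ifs with hi h2
    · rfl
    · exact absurd (by rw [Finset.card_erase_of_mem hi, h]; rfl) h2
    · rfl
  · refine Finset.sum_eq_zero fun i _ => ?_
    split_ifs with hi h2
    · rw [Finset.card_erase_of_mem hi] at h2
      have := Finset.card_pos.2 ⟨i, hi⟩
      omega
    · simp
    · rfl

theorem extOp_degPart_zero (φ : Fin n → M →+ N) (ω : Finset (Fin n) → M) :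
    degPart 0 (extOp φ ω) = 0 := by
  ext I
  simp only [extOp_apply, degPart]
  split_ifs with h
  · rw [Finset.card_eq_zero.1 h]
    simp
  · rfl

theorem degPart_degPart (p : ℕ) (ω : Finset (Fin n) → M) :
    degPart p (degPart p ω) = degPart p ω := by
  ext I
  simp only [degPart]
  split_ifs <;> rfl

theorem degPart_add (p : ℕ) (ω η : Finset (Fin n) → M) :
    degPart p (ω + η) = degPart p ω + degPart p η := by
  ext I
  simp only [degPart, Pi.add_apply]
  split_ifs <;> simp

/-- The sign of the star operator. -/
def starSign (J : Finset (Fin n)) : ℤ := ∏ j ∈ J, (-1) ^ (j : ℕ)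

theorem starSign_mul_compl (J : Finset (Fin n)) :
    starSign J * starSign Jᶜ = starSign (Finset.univ : Finset (Fin n)) :=
  Finset.prod_mul_prod_compl J _

theorem starSign_mul_self (J : Finset (Fin n)) : starSign J * starSign J = 1 := by
  rw [starSign, ← Finset.prod_mul_distrib]
  exact Finset.prod_eq_one fun j _ => by rw [← mul_pow]; simp

/-- The star operator, which exchanges forms of complementary degrees. -/
def complStar (ω : Finset (Fin n) → M) : Finset (Fin n) → M := fun J => starSign J • ω Jᶜ

/-- This splitting of `i` motivates the factor `(-1) ^ j` in `starSign`: inserting `i` into `J`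
changes `starSign` by the product of the position signs of `i` in `J` and in its complement. -/
theorem numBelow_add_numBelow_compl (J : Finset (Fin n)) (i : Fin n) :
    numBelow J i + numBelow Jᶜ i = i := by
  rw [numBelow, numBelow, ← Finset.card_union_of_disjoint, ← Finset.filter_union,
    Finset.union_compl]
  · rw [Finset.filter_gt_eq_Iio, Fin.card_Iio]
  · exact Finset.disjoint_filter_filter disjoint_compl_right

theorem complStar_wedge (i : Fin n) (ω : Finset (Fin n) → M) :
    complStar (wedge M i ω) = contract M i (complStar ω) := by
  ext J
  simp only [complStar, wedge_apply, contract_apply, Finset.mem_compl]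
  by_cases hi : i ∈ J
  · simp [hi]
  · have h1 : starSign (insert i J) = (-1) ^ (i : ℕ) * starSign J := Finset.prod_insert hi
    rw [if_pos hi, if_neg hi, smul_smul, smul_smul, h1, Finset.compl_insert,
      ← numBelow_add_numBelow_compl J i, pow_add]
    congr 1
    have h2 : ((-1 : ℤ) ^ numBelow J i) * (-1) ^ numBelow J i = 1 := by rw [← mul_pow]; simp
    linear_combination (-(-1 : ℤ) ^ numBelow Jᶜ i * starSign J) * h2

theorem complStar_extOp (φ : Fin n → M →+ N) (ω : Finset (Fin n) → M) :
    complStar (extOp φ ω) = intOp φ (complStar ω) := by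
  have hsum : ∀ g : Fin n → Finset (Fin n) → N, complStar (∑ i, g i) = ∑ i, complStar (g i) := fun g => by
    ext J
    simp [complStar, Finset.smul_sum]
  rw [extOp_def, intOp_def, hsum]
  refine Finset.sum_congr rfl fun i _ => ?_
  rw [complStar_wedge]
  congr 1
  ext J
  simp [complStar]

theorem complStar_complStar (ω : Finset (Fin n) → M) :
    complStar (complStar ω) = starSign (Finset.univ : Finset (Fin n)) • ω := by
  ext J
  simp [complStar, smul_smul, starSign_mul_compl]

theorem complStar_zsmul (c : ℤ) (ω : Finset (Fin n) → M) : complStar (c • ω) = c • complStar ω := by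
  ext J
  simp [complStar, smul_comm c]

/-- The star operator squares to a global sign. -/
theorem complStar_bijective : Function.Bijective (complStar : (Finset (Fin n) → M) → _) := by
  have h : ∀ ω : Finset (Fin n) → M,
      starSign (Finset.univ : Finset (Fin n)) • complStar (complStar ω) = ω := fun ω => by
    rw [complStar_complStar, smul_smul, starSign_mul_self, one_smul]
  refine ⟨fun ω η hωη => ?_, fun ω => ⟨_, (complStar_zsmul _ _).trans (h ω)⟩⟩
  rw [← h ω, hωη, h η]

end TotalForms

/-! ### Depth sensitivity of the Koszul complex. -/

section KoszulExactness

variable {n : ℕ}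

/-- Multiplication by the elements `g i` of the ring `R`, as additive operators. -/
def smulOp (R M : Type*) [CommRing R] [AddCommGroup M] [Module R M] (g : Fin n → R) :
    Fin n → M →+ M := fun i => DistribSMul.toAddMonoidHom M (g i)

theorem smulOp_apply {R M : Type*} [CommRing R] [AddCommGroup M] [Module R M] (g : Fin n → R)
    (i : Fin n) (m : M) : smulOp R M g i m = g i • m := rfl

theorem extOp_smulOp_smul {R M : Type*} [CommRing R] [AddCommGroup M] [Module R M]
    (g : Fin n → R) (a : R) (ω : Finset (Fin n) → M) :
    extOp (smulOp R M g) (a • ω) = a • extOp (smulOp R M g) ω :=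
  extOp_comp (smulOp R M g) (smulOp R M g) (DistribSMul.toAddMonoidHom M a)
    (DistribSMul.toAddMonoidHom M a) (fun i x => smul_comm (g i) a x) ω

theorem extOp_smulOp_smulOp {R M : Type*} [CommRing R] [AddCommGroup M] [Module R M]
    [IsAddTorsionFree M] (g : Fin n → R) (ω : Finset (Fin n) → M) :
    extOp (smulOp R M g) (extOp (smulOp R M g) ω) = 0 :=
  extOp_extOp_self _ (fun i j x => smul_comm (g i) (g j) x) ω

/-- Elements of the ideal generated by `g` are homotopic to zero on the Koszul complex of `g`. -/
theorem smul_eq_koszul_homotopy {R M : Type*} [CommRing R] [AddCommGroup M] [Module R M]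
    (g c : Fin n → R) (ω : Finset (Fin n) → M) :
    (∑ i, c i * g i) • ω = extOp (smulOp R M g) (intOp (smulOp R M c) ω) +
      intOp (smulOp R M c) (extOp (smulOp R M g) ω) := by
  have h0 : ∀ i j : Fin n, (fun I => smulOp R M g i (smulOp R M c j (ω I)) -
      smulOp R M c j (smulOp R M g i (ω I))) = 0 := fun i j => by
    ext I
    simp only [smulOp_apply, smul_comm (g i), sub_self, Pi.zero_apply]
  rw [extOp_intOp_add]
  simp only [h0, map_zero, Finset.sum_const_zero, add_zero]
  ext I
  simp [smulOp_apply, smul_smul, Finset.sum_smul]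

/-- Contraction lowers the degree by one; this matches the loss of one element of the regular
sequence in the induction below. -/
theorem intOp_eq_zero_of_le {M N : Type*} [AddCommGroup M] [AddCommGroup N] {k : ℕ}
    (φ : Fin n → M →+ N) {ω : Finset (Fin n) → M} (hω : ∀ I, k + 1 ≤ I.card → ω I = 0)
    (I : Finset (Fin n)) (hI : k ≤ I.card) : intOp φ ω I = 0 := by
  rw [intOp_apply]
  refine Finset.sum_eq_zero fun i _ => ?_
  split_ifs with hi
  · rfl
  · rw [hω, map_zero, smul_zero]
    rw [Finset.card_insert_of_notMem hi]
    omega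

/-- The sequence `ys` is weakly regular modulo the ideal `I`. -/
def IsRegularMod {R : Type*} [CommRing R] : Ideal R → List R → Prop
  | _, [] => True
  | I, y :: ys => (∀ a, y * a ∈ I → a ∈ I) ∧ IsRegularMod (I ⊔ Ideal.span {y}) ys

/-- Depth sensitivity of the Koszul complex: modulo `I` it is exact in degrees smaller than the
length of a sequence in the ideal generated by `g` that is regular modulo `I`. -/
theorem koszul_exact_mod_of_isRegularMod {R : Type*} [CommRing R] [IsAddTorsionFree R]
    (g : Fin n → R) (ys : List R) (hys : ∀ y ∈ ys, y ∈ Ideal.span (Set.range g)) :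
    ∀ (I : Ideal R) (_ : IsRegularMod I ys) (ω : Finset (Fin n) → R)
      (_ : ∀ A, ys.length ≤ A.card → ω A = 0)
      (_ : ∀ A, extOp (smulOp R R g) ω A ∈ I),
      ∃ η, ∀ A, ω A - extOp (smulOp R R g) η A ∈ I := by
  have hext : ∀ (I : Ideal R) (ω : Finset (Fin n) → R), (∀ A, ω A ∈ I) →
      ∀ A, extOp (smulOp R R g) ω A ∈ I := fun I ω hω A => by
    rw [extOp_apply]
    refine Ideal.sum_mem _ fun i _ => ?_
    split_ifs
    · exact zsmul_mem (I.mul_mem_left _ (hω _)) _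
    · exact I.zero_mem
  have hint : ∀ (c : Fin n → R) (I : Ideal R) (ω : Finset (Fin n) → R), (∀ A, ω A ∈ I) →
      ∀ A, intOp (smulOp R R c) ω A ∈ I := fun c I ω hω A => by
    rw [intOp_apply]
    refine Ideal.sum_mem _ fun i _ => ?_
    split_ifs
    · exact I.zero_mem
    · exact zsmul_mem (I.mul_mem_left _ (hω _)) _
  induction ys with
  | nil =>
    intro I _ ω hω _
    refine ⟨0, fun A => ?_⟩
    rw [hω A (Nat.zero_le _), map_zero]
    simp
  | cons y ys ih =>
    intro I hreg ω hω hclosed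
    obtain ⟨c, hc⟩ := Ideal.mem_span_range_iff_exists_fun.1 (hys y List.mem_cons_self)
    have hhom := smul_eq_koszul_homotopy (M := R) g c ω
    rw [hc] at hhom
    set η := intOp (smulOp R R c) ω
    -- As `ω` is closed modulo `I`, the homotopy given by `y = ∑ c i * g i` shows that `y ω` is the
    -- differential of `η` modulo `I`.
    have hη : ∀ A, y * ω A - extOp (smulOp R R g) η A ∈ I := fun A => by
      have h1 := congrFun hhom A
      rw [Pi.smul_apply, smul_eq_mul, Pi.add_apply] at h1
      rw [h1, add_sub_cancel_left]
      exact hint c I _ hclosed A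
    -- Modulo `I` and `y` the form `η` is closed, and its degrees are below the length of `ys`.
    obtain ⟨ζ, hζ⟩ := ih (fun y hy => hys y (List.mem_cons_of_mem _ hy)) _ hreg.2 η
      (intOp_eq_zero_of_le _ hω) (fun A => by
        have h1 : extOp (smulOp R R g) η A =
            y * ω A - (y * ω A - extOp (smulOp R R g) η A) := by ring
        rw [h1]
        exact sub_mem (Ideal.mem_sup_right (Ideal.mul_mem_right _ _
          (Ideal.mem_span_singleton_self y))) (Ideal.mem_sup_left (hη A)))
    have hdec : ∀ A, ∃ t, η A - extOp (smulOp R R g) ζ A - y * t ∈ I := fun A => by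
      obtain ⟨u, hu, v, hv, huv⟩ := Submodule.mem_sup.1 (hζ A)
      obtain ⟨t, rfl⟩ := Ideal.mem_span_singleton'.1 hv
      refine ⟨t, ?_⟩
      rw [← huv, mul_comm y t, add_sub_cancel_right]
      exact hu
    choose θ hθ using hdec
    -- With `e` the Koszul differential, `η = e ζ + y θ` modulo `I` gives `y ω = e η = y e θ`;
    -- regularity cancels `y`.
    refine ⟨θ, fun A => hreg.1 _ ?_⟩
    have h2 := hext I (η - extOp (smulOp R R g) ζ - y • θ) hθ A
    rw [map_sub, map_sub, extOp_smulOp_smulOp, extOp_smulOp_smul, sub_zero, Pi.sub_apply,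
      Pi.smul_apply, smul_eq_mul] at h2
    have h3 := I.add_mem (hη A) h2
    rwa [sub_add_sub_cancel, ← mul_sub] at h3

end KoszulExactness

/-! ### Exactness of the Koszul complex of the partial derivatives. -/

section JacobianKoszul

open MvPolynomial

variable {K : Type*} [Field K] {n : ℕ}

theorem mem_span_X_pow_iff (N : Fin n → ℕ) (s : Set (Fin n)) (p : MvPolynomial (Fin n) K) :
    p ∈ Ideal.span ((fun i => (X i ^ N i : MvPolynomial (Fin n) K)) '' s) ↔
      ∀ m ∈ p.support, ∃ i ∈ s, N i ≤ m i := by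
  have h : (fun i => (X i ^ N i : MvPolynomial (Fin n) K)) '' s =
      (fun m => monomial m (1 : K)) '' ((fun i => Finsupp.single i (N i)) '' s) := by
    rw [Set.image_image]
    simp only [X_pow_eq_monomial]
  rw [h, mem_ideal_span_monomial_image]
  simp

/-- Membership in a monomial ideal is tested on exponents, and multiplication by a power of `X j`
leaves the exponents of the variables in `s` unchanged. -/
theorem isRegularMod_X_pow (N : Fin n → ℕ) (l : List (Fin n)) (hl : l.Nodup) :
    ∀ (s : Set (Fin n)) (_ : ∀ i ∈ l, i ∉ s),
      IsRegularMod (Ideal.span ((fun i => (X i ^ N i : MvPolynomial (Fin n) K)) '' s))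
        (l.map fun i => X i ^ N i) := by
  induction l with
  | nil => exact fun _ _ => trivial
  | cons j l ih =>
    intro s hs
    refine ⟨fun a ha => ?_, ?_⟩
    · rw [mem_span_X_pow_iff] at ha ⊢
      intro m hm
      obtain ⟨i, his, hi⟩ := ha (Finsupp.single j (N j) + m) (by
        dsimp only
        rw [mem_support_iff, X_pow_eq_monomial, coeff_monomial_mul, one_mul]
        exact mem_support_iff.1 hm)
      refine ⟨i, his, ?_⟩
      have hij : i ≠ j := fun h => hs j List.mem_cons_self (h ▸ his)
      simpa [Finsupp.single_apply, hij.symm] using hi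
    · have h := ih (List.nodup_cons.1 hl).2 (insert j s) (fun i hi => by
        rw [Set.mem_insert_iff, not_or]
        exact ⟨fun h => (List.nodup_cons.1 hl).1 (h ▸ hi), hs i (List.mem_cons_of_mem _ hi)⟩)
      rwa [Set.image_insert_eq, Ideal.span_insert, sup_comm] at h

/-- The Koszul complex of the partial derivatives of an isolated singularity is exact outside
the top degree. -/
theorem IsIsolatedSingularity.koszul_exact [CharZero K] {w : Fin n → ℕ}
    {f : MvPolynomial (Fin n) K} (hf0 : f ≠ 0) {d : ℕ} (hd : 0 < d)
    (hf : MvPolynomial.IsWeightedHomogeneous w f d) (hiso : IsIsolatedSingularity w f)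
    (ω : Finset (Fin n) → MvPolynomial (Fin n) K) (hω : ∀ A, n ≤ A.card → ω A = 0)
    (hclosed : extOp (smulOp _ (MvPolynomial (Fin n) K) fun i => pderiv i f) ω = 0) :
    ∃ η, ω = extOp (smulOp _ (MvPolynomial (Fin n) K) fun i => pderiv i f) η := by
  choose N hN using fun i => Ideal.mem_radical_iff.1 (hiso.X_mem_radical hf0 hd hf i)
  -- The partial derivatives need not be shown to form a regular sequence: it is enough that their
  -- ideal contains one of length `n`.
  have hreg := isRegularMod_X_pow (K := K) N (List.finRange n) (List.nodup_finRange n) ∅ (by simp)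
  rw [Set.image_empty, Ideal.span_empty] at hreg
  obtain ⟨η, hη⟩ := koszul_exact_mod_of_isRegularMod (fun i => pderiv i f) _
    (by
      intro y hy
      obtain ⟨i, _, rfl⟩ := List.mem_map.1 hy
      exact hN i) ⊥ hreg ω (by simpa using hω) (fun A => by rw [hclosed]; exact zero_mem _)
  exact ⟨η, funext fun A => sub_eq_zero.1 ((Submodule.mem_bot _).1 (hη A))⟩

end JacobianKoszul

/-! ### Operators homotopic to zero and their nonzero eigenvalues. -/

section LinearAlgebra

variable {K V W : Type*} [Field K] [AddCommGroup V] [Module K V] [AddCommGroup W] [Module K W]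

theorem map_aeval_of_commute (T : V →+ W) (hT : ∀ (c : K) x, T (c • x) = c • T x)
    (L : Module.End K V) (L' : Module.End K W) (hL : ∀ x, T (L x) = L' (T x))
    (Q : Polynomial K) (x : V) :
    T (Polynomial.aeval L Q x) = Polynomial.aeval L' Q (T x) := by
  induction Q using Polynomial.induction_on' generalizing x with
  | add p q hp hq => simp only [map_add, LinearMap.add_apply, hp, hq]
  | monomial k c =>
    simp only [Polynomial.aeval_monomial, Module.algebraMap_end_eq_smul_id, Module.End.mul_apply,
      LinearMap.smul_apply, LinearMap.id_apply, hT]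
    congr 1
    induction k generalizing x with
    | zero => rfl
    | succ k ih => rw [pow_succ, pow_succ, Module.End.mul_apply, Module.End.mul_apply, ih, hL]

/-- The vectors annihilated by a polynomial in `L` with nonzero constant term. -/
def nonzeroPart (L : Module.End K V) : Submodule K V where
  carrier := {x | ∃ Q : Polynomial K, Q.coeff 0 ≠ 0 ∧ Polynomial.aeval L Q x = 0}
  zero_mem' := ⟨1, by simp, map_zero _⟩
  add_mem' := by
    rintro x y ⟨P, hP, hPx⟩ ⟨Q, hQ, hQy⟩
    refine ⟨P * Q, by rw [Polynomial.mul_coeff_zero]; exact mul_ne_zero hP hQ, ?_⟩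
    rw [map_add]
    nth_rewrite 1 [mul_comm P Q]
    rw [map_mul, map_mul, Module.End.mul_apply, Module.End.mul_apply, hPx, hQy, map_zero,
      map_zero, add_zero]
  smul_mem' := by
    rintro c x ⟨P, hP, hPx⟩
    exact ⟨P, hP, by rw [map_smul, hPx, smul_zero]⟩

theorem mem_nonzeroPart_iff {L : Module.End K V} {x : V} : x ∈ nonzeroPart L ↔
    ∃ Q : Polynomial K, Q.coeff 0 ≠ 0 ∧ Polynomial.aeval L Q x = 0 := Iff.rfl

/-- If `L` is homotopic to zero, cocycles in its nonzero part are coboundaries. -/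
theorem exists_of_mem_nonzeroPart (d h : V →+ V) (hd : ∀ (c : K) x, d (c • x) = c • d x)
    (hdd : ∀ x, d (d x) = 0) (L : Module.End K V) (hL : ∀ x, L x = d (h x) + h (d x)) {x : V}
    (hx : d x = 0) (hmem : x ∈ nonzeroPart L) : ∃ y, x = d y := by
  obtain ⟨Q, hQ, hQx⟩ := mem_nonzeroPart_iff.1 hmem
  have h1 := hL x
  rw [hx, map_zero, add_zero] at h1
  have h2 := map_aeval_of_commute d hd L L
    (fun x => by rw [hL, hL, map_add, hdd, hdd, map_zero, zero_add, add_zero]) Q.divX (h x)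
  have h3 : Polynomial.aeval L Q x =
      Polynomial.aeval L Q.divX (L x) + Q.coeff 0 • x := by
    conv_lhs => rw [← Polynomial.divX_mul_X_add Q]
    rw [map_add, map_mul, Polynomial.aeval_X, Polynomial.aeval_C, LinearMap.add_apply,
      Module.End.mul_apply, Module.algebraMap_end_apply]
  rw [hQx, h1, ← h2] at h3
  -- From `Q = X * Q.divX + Q.coeff 0` and `L x = d (h x)`: `0 = Q(L) x = d (Q.divX(L) (h x)) +
  -- Q.coeff 0 • x`, because `L` commutes with `d`.
  refine ⟨(Q.coeff 0)⁻¹ • -Polynomial.aeval L Q.divX (h x), ?_⟩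
  rw [hd, map_neg, eq_inv_smul_iff₀ hQ]
  exact (neg_eq_of_add_eq_zero_right h3.symm).symm

theorem mem_nonzeroPart_of_eigenvector (L : Module.End K V) {x : V} {c : K} (hc : c ≠ 0)
    (hx : L x = c • x) : x ∈ nonzeroPart L :=
  ⟨Polynomial.X - Polynomial.C c, by simpa using hc, by
    simp [hx, Module.algebraMap_end_apply]⟩

/-- An annihilating polynomial passes along any intertwining map, so no decomposition of the target
into eigenspaces is needed. -/
theorem map_mem_nonzeroPart (T : V →+ W) (hT : ∀ (c : K) x, T (c • x) = c • T x)
    (L : Module.End K V) (L' : Module.End K W) (hL : ∀ x, T (L x) = L' (T x)) {x : V}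
    (hx : x ∈ nonzeroPart L) : T x ∈ nonzeroPart L' := by
  obtain ⟨Q, hQ, hQx⟩ := mem_nonzeroPart_iff.1 hx
  exact ⟨Q, hQ, by rw [← map_aeval_of_commute T hT L L' hL, hQx, map_zero]⟩

end LinearAlgebra

/-! ### Lie derivative along the Euler field and Cartan's formula. -/

section Cartan

variable {K S : Type*} [Field K] [CommRing S] [Algebra K S] {n : ℕ}

/-- The derivations `D i` as additive operators. -/
def derOp (D : Fin n → Derivation K S S) : Fin n → S →+ S :=
  fun i => (D i).toLinearMap.toAddMonoidHom

theorem derOp_apply (D : Fin n → Derivation K S S) (i : Fin n) (s : S) : derOp D i s = D i s :=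
  rfl

theorem extOp_derOp_smul_field (D : Fin n → Derivation K S S) (c : K)
    (ω : Finset (Fin n) → S) : extOp (derOp D) (c • ω) = c • extOp (derOp D) ω :=
  extOp_comp (derOp D) (derOp D) (DistribSMul.toAddMonoidHom S c)
    (DistribSMul.toAddMonoidHom S c) (fun i x => (D i).map_smul c x) ω

/-- The Leibniz rule `d (s ω) = ds ∧ ω + s dω`. -/
theorem extOp_derOp_smul (D : Fin n → Derivation K S S) (s : S) (ω : Finset (Fin n) → S) :
    extOp (derOp D) (s • ω) =
      extOp (smulOp S S fun i => D i s) ω + s • extOp (derOp D) ω := by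
  ext I
  simp only [extOp_apply, Pi.add_apply, Pi.smul_apply, smul_eq_mul, Finset.mul_sum,
    ← Finset.sum_add_distrib, derOp_apply, smulOp_apply, Derivation.leibniz]
  refine Finset.sum_congr rfl fun i _ => ?_
  split_ifs
  · rw [smul_add, add_comm, mul_smul_comm, mul_comm (ω _)]
  · simp

variable (D : Fin n → Derivation K S S) (hD : ∀ i j s, D i (D j s) = D j (D i s))
  (x : Fin n → S) (hx : ∀ i j, D i (x j) = if i = j then 1 else 0) (w : Fin n → ℕ)

include hD in
theorem extOp_derOp_derOp [IsAddTorsionFree S] (ω : Finset (Fin n) → S) :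
    extOp (derOp D) (extOp (derOp D) ω) = 0 :=
  extOp_extOp_self _ hD ω

/-- The Euler operator `∑ w_j x_j D_j`. -/
def eulerOp : Module.End K S :=
  ∑ j, (w j : K) • LinearMap.mulLeft K (x j) ∘ₗ (D j).toLinearMap

theorem eulerOp_apply (s : S) : eulerOp D x w s = ∑ j, (w j : K) • (x j * D j s) := by
  simp [eulerOp]

theorem eulerOp_mul (s t : S) :
    eulerOp D x w (s * t) = eulerOp D x w s * t + s * eulerOp D x w t := by
  simp only [eulerOp_apply, Finset.sum_mul, Finset.mul_sum, ← Finset.sum_add_distrib,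
    Derivation.leibniz, smul_eq_mul]
  refine Finset.sum_congr rfl fun j _ => ?_
  rw [smul_mul_assoc, mul_smul_comm, ← smul_add]
  ring_nf

include hD hx in
-- Differentiation with respect to `x i` lowers the weight by `w i`.
theorem eulerOp_der (i : Fin n) (s : S) :
    eulerOp D x w (D i s) = D i (eulerOp D x w s) - (w i : K) • D i s := by
  simp only [eulerOp_apply, map_sum, Derivation.map_smul, Derivation.leibniz, smul_eq_mul, hx,
    smul_add, Finset.sum_add_distrib, hD i]
  simp

/-- The weight of a set of indices. -/
def setWeight (I : Finset (Fin n)) : K := ∑ i ∈ I, (w i : K)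

/-- The Lie derivative along the Euler field. -/
def lieOp : Module.End K (Finset (Fin n) → S) where
  toFun ω I := eulerOp D x w (ω I) + setWeight (K := K) w I • ω I
  map_add' ω η := by
    ext I
    simp only [Pi.add_apply, map_add, smul_add]
    abel
  map_smul' c ω := by
    ext I
    simp only [Pi.smul_apply, map_smul, smul_add, RingHom.id_apply, smul_comm c]

theorem lieOp_apply (ω : Finset (Fin n) → S) (I : Finset (Fin n)) :
    lieOp D x w ω I = eulerOp D x w (ω I) + setWeight (K := K) w I • ω I := rfl

/-- Contraction with the Euler field. -/
def eulerContract : (Finset (Fin n) → S) →+ (Finset (Fin n) → S) :=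
  intOp (smulOp S S fun j => (w j : K) • x j)

include hx in
/-- Cartan's formula for the Euler field. -/
theorem lieOp_eq (ω : Finset (Fin n) → S) :
    lieOp D x w ω = extOp (derOp D) (eulerContract (K := K) x w ω) +
      eulerContract (K := K) x w (extOp (derOp D) ω) := by
  rw [eulerContract, extOp_intOp_add]
  ext I
  -- The commutator of `D i` with multiplication by `w j x j` is `w i` for `i = j` and zero
  -- otherwise. Its contribution is the weight of `dx_I`.
  have h0 : ∀ i j : Fin n, (fun I => derOp D i (smulOp S S (fun j => (w j : K) • x j) j (ω I)) -
      smulOp S S (fun j => (w j : K) • x j) j (derOp D i (ω I))) =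
      if i = j then DistribSMul.toAddMonoidHom S (w i : K) ∘ ω else 0 := fun i j => by
    ext I
    simp only [smulOp_apply, derOp_apply, smul_mul_assoc, smul_eq_mul, Derivation.map_smul,
      Derivation.leibniz, hx, smul_add]
    split_ifs with h
    · subst h
      simp
    · simp
  rw [lieOp_apply, eulerOp_apply, Pi.add_apply, Finset.sum_apply, setWeight]
  congr 1
  · simp [smulOp_apply, derOp_apply]
  · have h1 : ∀ i, ∑ j, wedge S i (contract S j (if i = j then
        (DistribSMul.toAddMonoidHom S (w i : K) ∘ ω) else 0)) =
        wedge S i (contract S i (DistribSMul.toAddMonoidHom S (w i : K) ∘ ω)) := fun i => by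
      rw [Finset.sum_eq_single i]
      · rw [if_pos rfl]
      · intro j _ hj
        rw [if_neg hj.symm, map_zero, map_zero]
      · simp
    simp only [h0, h1, Finset.sum_apply, wedge_contract_self, Finset.sum_smul]
    rw [← Finset.sum_filter]
    simp

include hD hx in
/-- Closed forms without component of weight zero are exact. -/
theorem exists_extOp_of_mem_nonzeroPart [IsAddTorsionFree S] (ω : Finset (Fin n) → S)
    (hω : extOp (derOp D) ω = 0) (hmem : ω ∈ nonzeroPart (lieOp D x w)) :
    ∃ η, ω = extOp (derOp D) η :=
  exists_of_mem_nonzeroPart (K := K) (extOp (derOp D)) (eulerContract (K := K) x w)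
    (extOp_derOp_smul_field D) (extOp_derOp_derOp D hD) (lieOp D x w) (lieOp_eq D x hx w) hω hmem

/-- Exterior multiplication with a form of weight zero commutes with the Lie derivative. -/
theorem extOp_smulOp_lieOp (r : Fin n → S)
    (hr : ∀ i, eulerOp D x w (r i) = -((w i : K) • r i)) (ω : Finset (Fin n) → S) :
    extOp (smulOp S S r) (lieOp D x w ω) = lieOp D x w (extOp (smulOp S S r) ω) := by
  ext I
  rw [lieOp_apply, extOp_apply, extOp_apply, map_sum, Finset.smul_sum, ← Finset.sum_add_distrib]
  refine Finset.sum_congr rfl fun i _ => ?_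
  split_ifs with hi
  · have h1 : setWeight (K := K) w I = w i + setWeight w (I.erase i) :=
      (Finset.add_sum_erase I (fun i => (w i : K)) hi).symm
    rw [map_zsmul, smul_comm _ ((-1 : ℤ) ^ _) (_ : S), ← smul_add, smulOp_apply, smulOp_apply,
      smul_eq_mul, smul_eq_mul, eulerOp_mul, hr, lieOp_apply, h1, add_smul, mul_add]
    congr 1
    simp only [neg_mul, smul_mul_assoc, mul_smul_comm]
    abel
  · simp

end Cartan

/-! ### Weights of polynomial forms and the Poincaré lemma. -/

section PolynomialForms

open MvPolynomial

variable {K : Type*} [Field K] {n : ℕ}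

theorem pderiv_comm (i j : Fin n) (p : MvPolynomial (Fin n) K) :
    pderiv i (pderiv j p) = pderiv j (pderiv i p) := by
  have hp : ⁅pderiv (R := K) i, pderiv (R := K) j⁆ = 0 := by
    refine derivation_ext fun k => ?_
    rw [Derivation.commutator_apply, pderiv_X, pderiv_X, Pi.single_apply, Pi.single_apply]
    split_ifs <;> simp
  have := DFunLike.congr_fun hp p
  rwa [Derivation.commutator_apply, Derivation.zero_apply, sub_eq_zero] at this

theorem pderiv_X_eq_ite (i j : Fin n) :
    pderiv i (X j : MvPolynomial (Fin n) K) = if i = j then 1 else 0 := by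
  rw [pderiv_X, Pi.single_apply]
  simp only [eq_comm]

variable (w : Fin n → ℕ)

theorem MvPolynomial.IsWeightedHomogeneous.eulerOp_eq {w : Fin n → ℕ}
    {p : MvPolynomial (Fin n) K} {d : ℕ} (hp : IsWeightedHomogeneous w p d) :
    eulerOp (pderiv (R := K)) X w p = (d : K) • p := by
  rw [eulerOp_apply, Nat.cast_smul_eq_nsmul, ← hp.sum_weight_X_mul_pderiv]
  simp only [Nat.cast_smul_eq_nsmul]

theorem eulerOp_monomial (m : Fin n →₀ ℕ) (c : K) :
    eulerOp (pderiv (R := K)) X w (monomial m c) = (Finsupp.weight w m : K) • monomial m c :=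
  (isWeightedHomogeneous_monomial w m c rfl).eulerOp_eq

theorem coeff_eulerOp (m : Fin n →₀ ℕ) (p : MvPolynomial (Fin n) K) :
    coeff m (eulerOp (pderiv (R := K)) X w p) = Finsupp.weight w m * coeff m p := by
  induction p using MvPolynomial.induction_on' with
  | monomial u c =>
    rw [eulerOp_monomial, coeff_smul, coeff_monomial, smul_eq_mul]
    split_ifs with h
    · rw [h]
    · simp
  | add p q hp hq => rw [map_add, coeff_add, coeff_add, hp, hq, mul_add]

variable [CharZero K]

/-- A form without constant term is a sum of eigenvectors of the Lie derivative along the Euler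
field with nonzero eigenvalues. -/
theorem mem_nonzeroPart_of_coeff_eq_zero (hw : ∀ i, 0 < w i)
    (ω : Finset (Fin n) → MvPolynomial (Fin n) K) (hω : coeff 0 (ω ∅) = 0) :
    ω ∈ nonzeroPart (lieOp (pderiv (R := K)) X w) := by
  rw [← Finset.univ_sum_single ω]
  refine Submodule.sum_mem _ fun I _ => ?_
  have h1 : Pi.single I (ω I) = ∑ m ∈ (ω I).support,
      (Pi.single I (monomial m (coeff m (ω I))) : Finset (Fin n) → MvPolynomial (Fin n) K) := by
    conv_lhs => rw [(ω I).as_sum]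
    exact map_sum (AddMonoidHom.single (fun _ : Finset (Fin n) => MvPolynomial (Fin n) K) I) _ _
  rw [h1]
  refine Submodule.sum_mem _ fun m hm => ?_
  -- The form `X^m dx_I` has weight `weight m + ∑ w i` over `i ∈ I`. By positivity this is zero only
  -- for `m = 0` and `I = ∅`, a term excluded by `hω`.
  refine mem_nonzeroPart_of_eigenvector _
    (c := ((Finsupp.weight w m + ∑ i ∈ I, w i : ℕ) : K)) ?_ ?_
  · rw [Nat.cast_ne_zero]
    intro h0
    have h2 := Nat.eq_zero_of_add_eq_zero h0
    have hI : I = ∅ := by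
      by_contra hne
      obtain ⟨i, hi⟩ := Finset.nonempty_iff_ne_empty.2 hne
      exact (hw i).ne' (Finset.sum_eq_zero_iff.1 h2.2 i hi)
    have hm0 : m = 0 := by
      ext i
      by_contra hne
      have := Finsupp.le_weight_of_ne_zero' w hne
      have := hw i
      omega
    subst hI hm0
    exact mem_support_iff.1 hm hω
  · ext1 J
    rw [lieOp_apply, Pi.smul_apply]
    rcases eq_or_ne J I with rfl | hJ
    · rw [Pi.single_eq_same, eulerOp_monomial, ← add_smul, setWeight]
      push_cast
      rfl
    · rw [Pi.single_eq_of_ne hJ, map_zero, smul_zero, smul_zero, add_zero]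

theorem degPart_apply_empty {M : Type*} [AddCommGroup M] {p : ℕ} (hp : 1 ≤ p)
    (ω : Finset (Fin n) → M) : degPart p ω ∅ = 0 :=
  if_neg (by rw [Finset.card_empty]; omega)

/-- Exactness survives the passage to one degree; in degree zero the component is itself zero. -/
theorem exists_degPart_extOp {M N : Type*} [AddCommGroup M] [AddCommGroup N] (φ : Fin n → M →+ N)
    (p : ℕ) (η : Finset (Fin n) → M) : ∃ η', degPart p (extOp φ η) = extOp φ η' := by
  cases p with
  | zero => exact ⟨0, by rw [extOp_degPart_zero, map_zero]⟩
  | succ p => exact ⟨degPart p η, (extOp_degPart φ p η).symm⟩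

/-- The Poincaré lemma for polynomial forms. -/
theorem poincare_lemma (p : ℕ) (hp : 1 ≤ p) (ω : Finset (Fin n) → MvPolynomial (Fin n) K)
    (hω : extOp (derOp (pderiv (R := K))) (degPart p ω) = 0) :
    ∃ η, degPart p ω = extOp (derOp (pderiv (R := K))) η :=
  -- Any positive weights serve here; all weights one is the classical radial homotopy.
  exists_extOp_of_mem_nonzeroPart _ pderiv_comm X pderiv_X_eq_ite (fun _ => 1) _ hω
    (mem_nonzeroPart_of_coeff_eq_zero _ (fun _ => Nat.one_pos) _
      (by rw [degPart_apply_empty hp, coeff_zero]))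

end PolynomialForms

/-! ### Forms with poles along `f`. -/

section LocalizedForms

open MvPolynomial

variable {K : Type*} [Field K] {n : ℕ} (f : MvPolynomial (Fin n) K)

/-- The map from forms over `R` to forms over `R_f`. -/
noncomputable def locForm : (Finset (Fin n) → MvPolynomial (Fin n) K) →ₗ[K]
    (Finset (Fin n) → Localization.Away f) :=
  (IsScalarTower.toAlgHom K (MvPolynomial (Fin n) K) (Localization.Away f)).toLinearMap.compLeft _

theorem locForm_apply (ω : Finset (Fin n) → MvPolynomial (Fin n) K) (I : Finset (Fin n)) :
    locForm f ω I = algebraMap _ (Localization.Away f) (ω I) := rfl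

theorem locForm_smul (r : MvPolynomial (Fin n) K)
    (ω : Finset (Fin n) → MvPolynomial (Fin n) K) :
    locForm f (r • ω) = algebraMap _ (Localization.Away f) r • locForm f ω := by
  ext I
  simp [locForm_apply]

theorem locForm_degPart (p : ℕ) (ω : Finset (Fin n) → MvPolynomial (Fin n) K) :
    locForm f (degPart p ω) = degPart p (locForm f ω) := by
  ext I
  simp only [locForm_apply, degPart]
  split_ifs <;> simp

theorem degPart_smul {R M : Type*} [CommRing R] [AddCommGroup M] [Module R M] (p : ℕ) (s : R)
    (ω : Finset (Fin n) → M) : degPart p (s • ω) = s • degPart p ω := by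
  ext I
  simp only [degPart, Pi.smul_apply]
  split_ifs <;> simp

theorem extOp_locForm (ω : Finset (Fin n) → MvPolynomial (Fin n) K) :
    extOp (derOp (partialLoc f)) (locForm f ω) = locForm f (extOp (derOp (pderiv (R := K))) ω) :=
  extOp_comp (derOp (pderiv (R := K))) (derOp (partialLoc f))
    (algebraMap _ (Localization.Away f)).toAddMonoidHom
    (algebraMap _ (Localization.Away f)).toAddMonoidHom (partialLoc_algebraMap f) ω

/-- The differential `df`, as a family of polynomials. -/
noncomputable def polyGradient : Fin n → MvPolynomial (Fin n) K := fun i => pderiv i f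

/-- The inverse of `f` in `R_f`. -/
noncomputable def invLoc : Localization.Away f := IsLocalization.Away.invSelf f

theorem algebraMap_mul_invLoc : algebraMap _ (Localization.Away f) f * invLoc f = 1 :=
  IsLocalization.Away.mul_invSelf f

/-- Differentiate `f * f⁻¹ = 1` and induct. Poles are powers of `invLoc f`, so exponents stay
natural numbers. -/
theorem partialLoc_invLoc_pow (i : Fin n) (k : ℕ) : partialLoc f i (invLoc f ^ k) =
    -(k * invLoc f ^ (k + 1) * algebraMap _ (Localization.Away f) (pderiv i f)) := by
  have h1 : partialLoc f i (invLoc f) =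
      -(invLoc f ^ 2 * algebraMap _ (Localization.Away f) (pderiv i f)) := by
    have h2 := congrArg (partialLoc f i) (algebraMap_mul_invLoc f)
    rw [Derivation.leibniz, Derivation.map_one_eq_zero, partialLoc_algebraMap, smul_eq_mul,
      smul_eq_mul] at h2
    linear_combination invLoc f * h2 - partialLoc f i (invLoc f) * algebraMap_mul_invLoc f
  induction k with
  | zero => simp
  | succ k ih =>
    rw [pow_succ, Derivation.leibniz, ih, h1]
    simp only [smul_eq_mul]
    push_cast
    ring

/-- The differential of `α / f ^ k`. -/
theorem extOp_invLoc_pow_smul (k : ℕ) (α : Finset (Fin n) → MvPolynomial (Fin n) K) :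
    extOp (derOp (partialLoc f)) (invLoc f ^ k • locForm f α) =
      invLoc f ^ (k + 1) • locForm f (f • extOp (derOp (pderiv (R := K))) α -
        (k : MvPolynomial (Fin n) K) • extOp (smulOp _ _ (polyGradient f)) α) := by
  have h1 : extOp (smulOp (Localization.Away f) (Localization.Away f)
      fun i => partialLoc f i (invLoc f ^ k)) (locForm f α) =
      -((k : Localization.Away f) * invLoc f ^ (k + 1)) •
        locForm f (extOp (smulOp _ _ (polyGradient f)) α) :=
    extOp_comp (smulOp _ _ (polyGradient f)) _
      (algebraMap _ (Localization.Away f)).toAddMonoidHom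
      ((AddMonoidHom.mulLeft (-((k : Localization.Away f) * invLoc f ^ (k + 1)))).comp
        (algebraMap _ (Localization.Away f)).toAddMonoidHom) (fun i x => by
        rw [smulOp_apply, partialLoc_invLoc_pow]
        simp [smulOp_apply, polyGradient]
        ring) α
  rw [extOp_derOp_smul, h1, extOp_locForm, map_sub, locForm_smul, locForm_smul]
  ext I
  simp only [Pi.add_apply, Pi.smul_apply, Pi.sub_apply, smul_eq_mul, map_natCast]
  linear_combination (-invLoc f ^ k * locForm f (extOp (derOp (pderiv (R := K))) α) I) *
    algebraMap_mul_invLoc f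

/-- Every form over `R_f` has the shape `α / f ^ k`. -/
theorem exists_eq_invLoc_pow_smul (ω : Finset (Fin n) → Localization.Away f) :
    ∃ k α, ω = invLoc f ^ k • locForm f α := by
  obtain ⟨b, hb⟩ := IsLocalization.exist_integer_multiples_of_finite (Submonoid.powers f) ω
  obtain ⟨k, hk⟩ := b.2
  choose α hα using hb
  refine ⟨k, α, funext fun I => ?_⟩
  rw [Pi.smul_apply, locForm_apply, hα, ← hk]
  have h1 : algebraMap _ (Localization.Away f) (f ^ k) * invLoc f ^ k = 1 := by
    rw [map_pow, ← mul_pow, algebraMap_mul_invLoc, one_pow]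
  change _ = _ * (f ^ k • ω I)
  rw [Algebra.smul_def]
  linear_combination -ω I * h1

theorem algebraMap_loc_injective {f : MvPolynomial (Fin n) K} (hf0 : f ≠ 0) :
    Function.Injective (algebraMap (MvPolynomial (Fin n) K) (Localization.Away f)) :=
  IsLocalization.injective _ (powers_le_nonZeroDivisors_of_noZeroDivisors hf0)

theorem locForm_injective {f : MvPolynomial (Fin n) K} (hf0 : f ≠ 0) :
    Function.Injective (locForm f) := fun _ _ h =>
  funext fun I => algebraMap_loc_injective hf0 (congrFun h I)

theorem invLoc_pow_smul_eq_zero {f : MvPolynomial (Fin n) K} (hf0 : f ≠ 0) {k : ℕ}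
    {α : Finset (Fin n) → MvPolynomial (Fin n) K} (h : invLoc f ^ k • locForm f α = 0) :
    α = 0 := by
  refine locForm_injective hf0 ?_
  rw [map_zero]
  have h1 : algebraMap _ (Localization.Away f) (f ^ k) * invLoc f ^ k = 1 := by
    rw [map_pow, ← mul_pow, algebraMap_mul_invLoc, one_pow]
  rw [← one_smul (Localization.Away f) (locForm f α), ← h1, mul_smul, h, smul_zero]

end LocalizedForms

/-! ### Reduction of the pole order. -/

section PoleReduction

open MvPolynomial

variable {K : Type*} [Field K] [CharZero K] {n : ℕ} {f : MvPolynomial (Fin n) K}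

/-- The Koszul complex of the partial derivatives of `f` is exact outside the top degree. -/
def KoszulExact (f : MvPolynomial (Fin n) K) : Prop :=
  ∀ ω : Finset (Fin n) → MvPolynomial (Fin n) K, (∀ A, n ≤ A.card → ω A = 0) →
    extOp (smulOp _ (MvPolynomial (Fin n) K) (polyGradient f)) ω = 0 →
    ∃ η, ω = extOp (smulOp _ (MvPolynomial (Fin n) K) (polyGradient f)) η

theorem isAddTorsionFree_of_charZero (K : Type*) {V : Type*} [Field K] [CharZero K]
    [AddCommGroup V] [Module K V] : IsAddTorsionFree V :=
  ⟨fun k hk a b h => smul_right_injective V (Nat.cast_ne_zero (R := K).2 hk) (by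
    simpa only [Nat.cast_smul_eq_nsmul] using h)⟩

instance isAddTorsionFree_localizationAway (f : MvPolynomial (Fin n) K) :
    IsAddTorsionFree (Localization.Away f) :=
  isAddTorsionFree_of_charZero K

theorem degPart_eq_zero_of_ne {M : Type*} [AddCommGroup M] {p : ℕ} (ω : Finset (Fin n) → M)
    {A : Finset (Fin n)} (hA : A.card ≠ p) : degPart p ω A = 0 := if_neg hA

/-- If `f dα = k df ∧ α`, then `α` is a combination of a multiple of `f` and a multiple of `df`. -/
theorem KoszulExact.exists_decomposition (hK : KoszulExact f) (hf0 : f ≠ 0) {p : ℕ}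
    (hp : p + 2 ≤ n) (k : ℕ) (α : Finset (Fin n) → MvPolynomial (Fin n) K)
    (hα : f • extOp (derOp (pderiv (R := K))) (degPart p α) =
      (k : MvPolynomial (Fin n) K) • extOp (smulOp _ _ (polyGradient f)) (degPart p α)) :
    ∃ β γ, (k : MvPolynomial (Fin n) K) • degPart p α =
      f • β + extOp (smulOp _ _ (polyGradient f)) γ := by
  set e := extOp (smulOp _ (MvPolynomial (Fin n) K) (polyGradient f)) with he
  have hee : ∀ ω, e (e ω) = 0 := extOp_smulOp_smulOp _
  have hsmul : ∀ (a : MvPolynomial (Fin n) K) ω, e (a • ω) = a • e ω := extOp_smulOp_smul _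
  -- Applying `df ∧` to `hα` gives `f df ∧ dα = 0`. Since `dα` has degree `p + 1 < n`, exactness
  -- yields `dα = df ∧ β`.
  have h1 : e (extOp (derOp (pderiv (R := K))) (degPart p α)) = 0 := by
    have h2 := congrArg e hα
    rw [hsmul, hsmul, hee, smul_zero] at h2
    exact (smul_eq_zero.1 h2).resolve_left hf0
  rw [extOp_degPart] at h1
  obtain ⟨β, hβ⟩ := hK _ (fun A hA => degPart_eq_zero_of_ne _ (by omega)) h1
  have h3 : extOp (derOp (pderiv (R := K))) (degPart p α) = e (degPart p β) := by
    rw [he, extOp_degPart, extOp_degPart, ← hβ, degPart_degPart]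
  -- Now `k df ∧ α = f dα = f df ∧ β`, so `k α - f β` is killed by `df ∧`.
  obtain ⟨γ, hγ⟩ := hK ((k : MvPolynomial (Fin n) K) • degPart p α - f • degPart p β)
    (fun A hA => by
      rw [← degPart_smul, ← degPart_smul, Pi.sub_apply, degPart_eq_zero_of_ne _ (by omega),
        degPart_eq_zero_of_ne _ (by omega), sub_zero])
    (by rw [← he, map_sub, hsmul, hsmul, ← hα, h3, sub_self])
  exact ⟨degPart p β, γ, by rw [← hγ]; abel⟩

/-- Closed forms of degree at most `n - 2` are cohomologous to forms with a logarithmic pole. -/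
theorem KoszulExact.exists_logarithmic (hK : KoszulExact f) (hf0 : f ≠ 0) {p : ℕ}
    (hp : p + 2 ≤ n) (k : ℕ) : ∀ (α : Finset (Fin n) → MvPolynomial (Fin n) K)
    (_ : extOp (derOp (partialLoc f)) (invLoc f ^ k • locForm f (degPart p α)) = 0),
    ∃ β γ η, invLoc f ^ k • locForm f (degPart p α) =
      locForm f β + invLoc f • locForm f (extOp (smulOp _ _ (polyGradient f)) γ) +
        extOp (derOp (partialLoc f)) η := by
  induction k with
  | zero =>
    intro α _
    exact ⟨degPart p α, 0, 0, by simp⟩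
  | succ k ih =>
    intro α hα
    have hα0 := hα
    rw [extOp_invLoc_pow_smul] at hα0
    obtain ⟨β, γ, h1⟩ := hK.exists_decomposition hf0 hp (k + 1) α
      (sub_eq_zero.1 (invLoc_pow_smul_eq_zero hf0 hα0))
    have h2 := congrArg (locForm f) h1
    rw [map_add, locForm_smul, locForm_smul, map_natCast] at h2
    have hc : ∀ c : K, c ≠ 0 → algebraMap K (Localization.Away f) c⁻¹ * algebraMap K _ c = 1 :=
      fun c hc => by rw [← map_mul, inv_mul_cancel₀ hc, map_one]
    have hc1 := hc ((k + 1 : ℕ) : K) (Nat.cast_ne_zero.2 (Nat.succ_ne_zero k))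
    rw [map_natCast] at hc1
    have hfF := algebraMap_mul_invLoc f
    -- For a simple pole the decomposition of `α` is already the claim. The reduction below divides
    -- by the pole order minus one, which would be zero here.
    rcases k with _ | k
    · refine ⟨β, γ, 0, ?_⟩
      rw [map_zero, add_zero]
      ext I
      have h3 := congrFun h2 I
      simp only [Pi.smul_apply, Pi.add_apply, smul_eq_mul, zero_add, Nat.cast_one, one_mul,
        pow_one] at h3 ⊢
      linear_combination invLoc f * h3 + locForm f β I * hfF
    · have hc2 := hc ((k + 1 : ℕ) : K) (Nat.cast_ne_zero.2 (Nat.succ_ne_zero k))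
      rw [map_natCast] at hc2
      set c1 := ((k + 1 + 1 : ℕ) : K)⁻¹
      set c2 := ((k + 1 : ℕ) : K)⁻¹
      have h4 := extOp_invLoc_pow_smul f (k + 1) γ
      rw [map_sub, locForm_smul, locForm_smul, map_natCast] at h4
      -- Substitute `(k + 2) α = f β + df ∧ γ` and eliminate `df ∧ γ / f ^ (k + 2)` by means of `d
      -- (γ / f ^ (k + 1)) = dγ / f ^ (k + 1) - (k + 1) df ∧ γ / f ^ (k + 2)`.
      have h5 : invLoc f ^ (k + 1 + 1) • locForm f (degPart p α) =
          invLoc f ^ (k + 1) •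
            locForm f (c1 • β + (c1 * c2) • extOp (derOp (pderiv (R := K))) γ) +
          extOp (derOp (partialLoc f)) (-(c1 * c2) • invLoc f ^ (k + 1) • locForm f γ) := by
        rw [extOp_derOp_smul_field, h4, map_add, map_smul, map_smul]
        ext I
        have h3 := congrFun h2 I
        simp only [Pi.smul_apply, Pi.add_apply, Pi.sub_apply, smul_eq_mul] at h3 ⊢
        simp only [Algebra.smul_def, map_neg, map_mul] at h3 ⊢
        push_cast at h3 hc1 hc2 ⊢
        linear_combination (-(invLoc f ^ (k + 1 + 1) * locForm f (degPart p α) I)) * hc1 +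
          (algebraMap K _ c1 * invLoc f ^ (k + 1 + 1)) * h3 +
          (invLoc f ^ (k + 1) * algebraMap K _ c1 * locForm f β I +
            algebraMap K _ c1 * algebraMap K _ c2 * invLoc f ^ (k + 1) *
            locForm f (extOp (derOp (pderiv (R := K))) γ) I) * hfF -
          (algebraMap K _ c1 * invLoc f ^ (k + 1 + 1) *
            locForm f (extOp (smulOp _ _ (polyGradient f)) γ) I) * hc2
      -- `β` and `γ` need not have pure degree; the induction hypothesis wants the component of
      -- degree `p`.
      have h6 := congrArg (degPart p) h5
      obtain ⟨η', hη'⟩ := exists_degPart_extOp (derOp (partialLoc f)) p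
        (-(c1 * c2) • invLoc f ^ (k + 1) • locForm f γ)
      rw [degPart_add, hη', degPart_smul, degPart_smul, locForm_degPart, degPart_degPart,
        ← locForm_degPart, ← locForm_degPart] at h6
      have h7 := ih (c1 • β + (c1 * c2) • extOp (derOp (pderiv (R := K))) γ) (by
        rw [h6, map_add, extOp_derOp_derOp _ (partialLoc_comm f),
          add_zero] at hα
        exact hα)
      obtain ⟨β', γ', η, h8⟩ := h7
      exact ⟨β', γ', η + η', by rw [h6, h8, map_add]; abel⟩

end PoleReduction

/-! ### The form `df / f` and the cohomology of the complement. -/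

section LogarithmicForm

open MvPolynomial

variable {K : Type*} [Field K] {n : ℕ} (f : MvPolynomial (Fin n) K)

theorem algebraMap_loc_smul (c : K) (p : MvPolynomial (Fin n) K) :
    algebraMap _ (Localization.Away f) (c • p) = c • algebraMap _ (Localization.Away f) p :=
  map_smul (IsScalarTower.toAlgHom K (MvPolynomial (Fin n) K) (Localization.Away f)) c p

/-- The coefficients of `df / f`. -/
noncomputable def logCoeff : Fin n → Localization.Away f :=
  fun i => invLoc f * algebraMap _ (Localization.Away f) (pderiv i f)

theorem invLoc_smul_locForm (γ : Finset (Fin n) → MvPolynomial (Fin n) K) :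
    invLoc f • locForm f (extOp (smulOp _ _ (polyGradient f)) γ) =
      extOp (smulOp _ _ (logCoeff f)) (locForm f γ) :=
  (extOp_comp (smulOp _ _ (polyGradient f)) (smulOp _ _ (logCoeff f))
    (algebraMap (MvPolynomial (Fin n) K) (Localization.Away f)).toAddMonoidHom
    ((AddMonoidHom.mulLeft (invLoc f)).comp
      (algebraMap (MvPolynomial (Fin n) K) (Localization.Away f)).toAddMonoidHom) (fun i x => by
      simp [smulOp_apply, logCoeff, polyGradient, mul_assoc]) γ).symm

/-- The logarithmic form `df / f`. -/
noncomputable def logForm : Finset (Fin n) → Localization.Away f :=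
  extOp (smulOp _ _ (logCoeff f)) (locForm f (Pi.single ∅ 1))

theorem extOp_singleton {M N : Type*} [AddCommGroup M] [AddCommGroup N] (φ : Fin n → M →+ N)
    (ω : Finset (Fin n) → M) (i : Fin n) : extOp φ ω {i} = φ i (ω ∅) := by
  rw [extOp_apply, Finset.sum_eq_single i]
  · have h : numBelow {i} i = 0 := by
      rw [numBelow, Finset.card_eq_zero, Finset.filter_eq_empty_iff]
      intro j hj
      rw [Finset.mem_singleton.1 hj]
      exact lt_irrefl i
    simp [h]
  · intro j _ hj
    rw [if_neg (by simpa using hj)]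
  · simp

theorem logForm_singleton (i : Fin n) : logForm f {i} = logCoeff f i := by
  rw [logForm, extOp_singleton, smulOp_apply, locForm_apply, Pi.single_eq_same, map_one,
    smul_eq_mul, mul_one]

theorem degPart_zero_single {M : Type*} [AddCommGroup M] (x : M) :
    degPart 0 (Pi.single ∅ x : Finset (Fin n) → M) = Pi.single ∅ x := by
  ext I
  rw [degPart]
  split_ifs with h
  · rfl
  · rw [Pi.single_eq_of_ne]
    rintro rfl
    exact h Finset.card_empty

theorem degPart_logForm : degPart 1 (logForm f) = logForm f := by
  rw [logForm, ← extOp_degPart, ← locForm_degPart, degPart_zero_single]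

/-- In `d (df / f) = d (df) / f - df ∧ df / f ^ 2` both terms vanish. -/
theorem extOp_logForm [CharZero K] : extOp (derOp (partialLoc f)) (logForm f) = 0 := by
  have h1 : extOp (derOp (pderiv (R := K))) (Pi.single ∅ 1 : Finset (Fin n) → _) = 0 := by
    ext1 I
    rw [extOp_apply]
    refine Finset.sum_eq_zero fun i _ => ?_
    split_ifs
    · rw [derOp_apply]
      by_cases hI : I.erase i = ∅
      · rw [hI, Pi.single_eq_same, Derivation.map_one_eq_zero, smul_zero]
      · rw [Pi.single_eq_of_ne hI, map_zero, smul_zero]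
    · rfl
  have h2 : extOp (smulOp _ _ (polyGradient f)) (Pi.single ∅ 1) =
      extOp (derOp (pderiv (R := K))) (f • (Pi.single ∅ 1 : Finset (Fin n) → _)) := by
    rw [extOp_derOp_smul, h1, smul_zero, add_zero]
    rfl
  have h3 := extOp_invLoc_pow_smul f 1 (extOp (smulOp _ _ (polyGradient f)) (Pi.single ∅ 1))
  rw [extOp_smulOp_smulOp, h2, extOp_derOp_derOp _ pderiv_comm, smul_zero, smul_zero, sub_zero,
    map_zero, smul_zero, pow_one, ← h2, invLoc_smul_locForm] at h3
  exact h3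

variable {f} {w : Fin n → ℕ} {d : ℕ}

/-- The coordinate functions on the open set `f ≠ 0`. -/
noncomputable def locX (f : MvPolynomial (Fin n) K) : Fin n → Localization.Away f :=
  fun i => algebraMap (MvPolynomial (Fin n) K) _ (X i)

theorem partialLoc_locX (i j : Fin n) :
    partialLoc f i (locX f j) = if i = j then 1 else 0 := by
  rw [locX, partialLoc_algebraMap, pderiv_X_eq_ite]
  split_ifs <;> simp

theorem eulerOp_algebraMap (p : MvPolynomial (Fin n) K) :
    eulerOp (partialLoc f) (locX f) w (algebraMap _ _ p) =
      algebraMap _ (Localization.Away f) (eulerOp (pderiv (R := K)) X w p) := by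
  rw [eulerOp_apply, eulerOp_apply, map_sum]
  refine Finset.sum_congr rfl fun i _ => ?_
  rw [partialLoc_algebraMap, algebraMap_loc_smul, map_mul]
  rfl

theorem eulerOp_invLoc_pow (hf : IsWeightedHomogeneous w f d) (k : ℕ) :
    eulerOp (partialLoc f) (locX f) w (invLoc f ^ k) = -((k * d : ℕ) : K) • invLoc f ^ k := by
  have h1 := eulerOp_algebraMap (f := f) (w := w) f
  rw [hf.eulerOp_eq, Algebra.smul_def, map_mul, ← IsScalarTower.algebraMap_apply] at h1
  have h2 : eulerOp (partialLoc f) (locX f) w (1 : Localization.Away f) = 0 := by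
    rw [eulerOp_apply]
    simp
  have h3 : eulerOp (partialLoc f) (locX f) w (invLoc f) = -(d : K) • invLoc f := by
    rw [← algebraMap_mul_invLoc, eulerOp_mul, h1] at h2
    rw [Algebra.smul_def, map_neg]
    linear_combination invLoc f * h2 - (eulerOp (partialLoc f) (locX f) w (invLoc f) +
      algebraMap K _ (d : K) * invLoc f) * algebraMap_mul_invLoc f
  induction k with
  | zero => rw [pow_zero, h2]; simp
  | succ k ih =>
    rw [pow_succ, eulerOp_mul, ih, h3]
    simp only [Algebra.smul_def, map_neg, map_natCast]
    push_cast
    ring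

/-- As `f` has weight `d`, the form `df / f` has weight zero; hence multiplication by it commutes
with the Lie derivative. -/
theorem eulerOp_logCoeff (hf : IsWeightedHomogeneous w f d) (i : Fin n) :
    eulerOp (partialLoc f) (locX f) w (logCoeff f i) = -((w i : K) • logCoeff f i) := by
  have h := eulerOp_invLoc_pow hf 1
  rw [pow_one, one_mul] at h
  rw [logCoeff, eulerOp_mul, h, eulerOp_algebraMap, eulerOp_der _ pderiv_comm _ pderiv_X_eq_ite,
    hf.eulerOp_eq, Derivation.map_smul, map_sub, algebraMap_loc_smul, algebraMap_loc_smul]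
  simp only [Algebra.smul_def, map_neg]
  ring

theorem eulerOp_invLoc_pow_mul (hf : IsWeightedHomogeneous w f d) (k : ℕ)
    (α : MvPolynomial (Fin n) K) :
    eulerOp (partialLoc f) (locX f) w (invLoc f ^ k * algebraMap _ _ α) =
      invLoc f ^ k * algebraMap _ (Localization.Away f)
        (eulerOp (pderiv (R := K)) X w α - ((k * d : ℕ) : K) • α) := by
  rw [eulerOp_mul, eulerOp_invLoc_pow hf, eulerOp_algebraMap, map_sub, algebraMap_loc_smul]
  simp only [Algebra.smul_def, map_neg]
  ring

/-- Euler's identity divided by `f`: the contraction of `df / f` with the Euler field is the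
constant `d`. -/
theorem sum_locX_mul_logCoeff (hf : IsWeightedHomogeneous w f d) :
    ∑ i, (w i : K) • (locX f i * logCoeff f i) = algebraMap K _ (d : K) := by
  have h1 : ∑ i, (w i : K) • (locX f i * logCoeff f i) =
      invLoc f * algebraMap _ (Localization.Away f) (eulerOp (pderiv (R := K)) X w f) := by
    rw [eulerOp_apply, map_sum, Finset.mul_sum]
    refine Finset.sum_congr rfl fun i _ => ?_
    rw [algebraMap_loc_smul, map_mul, mul_smul_comm, logCoeff, locX]
    congr 1
    ring
  rw [h1, hf.eulerOp_eq, algebraMap_loc_smul, Algebra.smul_def]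
  linear_combination algebraMap K _ (d : K) * algebraMap_mul_invLoc f

theorem locForm_lieOp (ω : Finset (Fin n) → MvPolynomial (Fin n) K) :
    locForm f (lieOp (pderiv (R := K)) X w ω) =
      lieOp (partialLoc f) (locX f) w (locForm f ω) := by
  ext I
  rw [locForm_apply, lieOp_apply, lieOp_apply, locForm_apply, eulerOp_algebraMap, map_add,
    algebraMap_loc_smul]

theorem extOp_smulOp_smul_field {S : Type*} [CommRing S] [Algebra K S] (r : Fin n → S) (c : K)
    (ω : Finset (Fin n) → S) :
    extOp (smulOp S S r) (c • ω) = c • extOp (smulOp S S r) ω :=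
  extOp_comp (smulOp S S r) (smulOp S S r) (DistribSMul.toAddMonoidHom S c)
    (DistribSMul.toAddMonoidHom S c) (fun i x => smul_comm (r i) c x) ω

section

variable [CharZero K] (hw : ∀ i, 0 < w i) (γ : Finset (Fin n) → MvPolynomial (Fin n) K)
  (hγ : coeff 0 (γ ∅) = 0)

include hw hγ

theorem locForm_mem_nonzeroPart :
    locForm f γ ∈ nonzeroPart (lieOp (partialLoc f) (locX f) w) :=
  map_mem_nonzeroPart (K := K) (locForm f).toAddMonoidHom (fun c x => map_smul (locForm f) c x)
    _ _ locForm_lieOp (mem_nonzeroPart_of_coeff_eq_zero w hw γ hγ)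

theorem extOp_logCoeff_mem_nonzeroPart (hf : IsWeightedHomogeneous w f d) :
    extOp (smulOp _ _ (logCoeff f)) (locForm f γ) ∈
      nonzeroPart (lieOp (partialLoc f) (locX f) w) :=
  map_mem_nonzeroPart (K := K) _ (extOp_smulOp_smul_field (logCoeff f)) _ _
    (extOp_smulOp_lieOp _ _ _ _ (eulerOp_logCoeff hf)) (locForm_mem_nonzeroPart hw γ hγ)

end

variable [CharZero K]

/-- The logarithmic normal form, cut down to pure degree: this controls where constant terms can
occur. -/
theorem KoszulExact.exists_eq_add (hK : KoszulExact f) (hf0 : f ≠ 0) {p : ℕ}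
    (hp : p + 3 ≤ n) (ω : Finset (Fin n) → Localization.Away f) (hωp : degPart (p + 1) ω = ω)
    (hω : extOp (derOp (partialLoc f)) ω = 0) :
    ∃ β γ η, ω = locForm f (degPart (p + 1) β) +
      extOp (smulOp _ _ (logCoeff f)) (locForm f (degPart p γ)) +
        extOp (derOp (partialLoc f)) η := by
  obtain ⟨k, α, hα⟩ := exists_eq_invLoc_pow_smul f ω
  have h1 : ω = invLoc f ^ k • locForm f (degPart (p + 1) α) := by
    rw [locForm_degPart, ← degPart_smul, ← hα, hωp]
  obtain ⟨β, γ, η, h2⟩ := hK.exists_logarithmic hf0 (by omega) k α (h1 ▸ hω)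
  rw [← h1] at h2
  refine ⟨β, γ, degPart p η, ?_⟩
  rw [← hωp, h2, invLoc_smul_locForm, degPart_add, degPart_add, ← locForm_degPart,
    ← extOp_degPart, ← extOp_degPart, locForm_degPart f p]

/-- The cohomology of the complement of an isolated singularity vanishes in the degrees between
`2` and `n - 2`. -/
theorem KoszulExact.exists_primitive (hK : KoszulExact f) (hf0 : f ≠ 0) (hw : ∀ i, 0 < w i)
    (hf : IsWeightedHomogeneous w f d) {p : ℕ} (hp2 : 2 ≤ p)
    (hp : p + 2 ≤ n) (ω : Finset (Fin n) → Localization.Away f) (hωp : degPart p ω = ω)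
    (hω : extOp (derOp (partialLoc f)) ω = 0) : ∃ η, ω = extOp (derOp (partialLoc f)) η := by
  obtain ⟨p, rfl⟩ := Nat.exists_eq_add_of_le' hp2
  obtain ⟨β, γ, η, h1⟩ := hK.exists_eq_add hf0 (p := p + 1) (by omega) ω hωp hω
  have h2 := eq_sub_of_add_eq h1.symm
  -- Here both polynomial forms have positive degree, so neither has a constant function as a
  -- component.
  have hcoeff : ∀ (q : ℕ) (α : Finset (Fin n) → MvPolynomial (Fin n) K),
      coeff 0 (degPart (q + 1) α ∅) = 0 := fun q α => by
    rw [degPart_apply_empty (by omega), coeff_zero]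
  obtain ⟨η', h3⟩ := exists_extOp_of_mem_nonzeroPart _ (partialLoc_comm f) (locX f)
    partialLoc_locX w _
    (by rw [h2, map_sub, hω, extOp_derOp_derOp _ (partialLoc_comm f), sub_zero])
    (Submodule.add_mem _ (locForm_mem_nonzeroPart hw (degPart (p + 1 + 1) β) (hcoeff _ _))
      (extOp_logCoeff_mem_nonzeroPart hw (degPart (p + 1) γ) (hcoeff _ _) hf))
  exact ⟨η' + η, by rw [h1, h3, map_add]⟩

/-- The first cohomology of the complement of an isolated singularity in dimension at least `3`
is spanned by `df / f`. -/
theorem KoszulExact.exists_eq_logForm_add (hK : KoszulExact f) (hf0 : f ≠ 0)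
    (hw : ∀ i, 0 < w i) (hf : IsWeightedHomogeneous w f d) (hn : 3 ≤ n)
    (ω : Finset (Fin n) → Localization.Away f) (hωp : degPart 1 ω = ω)
    (hω : extOp (derOp (partialLoc f)) ω = 0) :
    ∃ (c : K) (η : _), ω = c • logForm f + extOp (derOp (partialLoc f)) η := by
  obtain ⟨β, γ, η, h1⟩ := hK.exists_eq_add hf0 (p := 0) (by omega) ω hωp hω
  -- Now `γ` is a function, and its constant term is the only contribution of weight zero. It
  -- produces `c • df / f`.
  set c := coeff 0 (degPart 0 γ (∅ : Finset (Fin n)))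
  set γ' := degPart 0 γ - c • (Pi.single ∅ 1 : Finset (Fin n) → MvPolynomial (Fin n) K) with hγ'
  have h2 : extOp (smulOp _ _ (logCoeff f)) (locForm f (degPart 0 γ)) =
      extOp (smulOp _ _ (logCoeff f)) (locForm f γ') + c • logForm f := by
    rw [logForm, ← extOp_smulOp_smul_field, ← map_smul, ← map_add, ← map_add, hγ',
      sub_add_cancel]
  have hγ'0 : coeff 0 (γ' ∅) = 0 := by
    rw [hγ', Pi.sub_apply, coeff_sub, Pi.smul_apply, Pi.single_eq_same, coeff_smul]
    simp [c]
  have h3 : locForm f (degPart (0 + 1) β) + extOp (smulOp _ _ (logCoeff f)) (locForm f γ') =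
      ω - extOp (derOp (partialLoc f)) η - c • logForm f := by
    rw [h1, h2]
    abel
  obtain ⟨η', h4⟩ := exists_extOp_of_mem_nonzeroPart _ (partialLoc_comm f) (locX f)
    partialLoc_locX w _
    (by rw [h3, map_sub, map_sub, hω, extOp_derOp_derOp _ (partialLoc_comm f),
          extOp_derOp_smul_field, extOp_logForm, smul_zero, sub_zero, sub_zero])
    (Submodule.add_mem _ (locForm_mem_nonzeroPart hw (degPart (0 + 1) β)
        (by rw [degPart_apply_empty le_rfl, coeff_zero]))
      (extOp_logCoeff_mem_nonzeroPart hw γ' hγ'0 hf))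
  refine ⟨c, η' + η, ?_⟩
  rw [map_add, ← h4, h3]
  abel

/-- The form `df / f` is not exact, not even modulo polynomial forms. -/
theorem logForm_ne_extOp_add (hf0 : f ≠ 0) (hd : 0 < d) (hf : IsWeightedHomogeneous w f d)
    (η : Finset (Fin n) → Localization.Away f)
    (β : Finset (Fin n) → MvPolynomial (Fin n) K) :
    logForm f ≠ extOp (derOp (partialLoc f)) η + locForm f β := by
  intro h
  have h1 := congrArg (degPart 1) h
  rw [degPart_logForm, degPart_add, ← extOp_degPart _ 0, ← locForm_degPart] at h1
  have h2 := congrArg (extOp (derOp (partialLoc f))) h1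
  rw [extOp_logForm, map_add, extOp_derOp_derOp _ (partialLoc_comm f), zero_add,
    extOp_locForm] at h2
  -- The polynomial form is closed in degree one, so its primitive can be absorbed: `df / f = dθ`
  -- for a function `θ` on the complement.
  obtain ⟨β', hβ'⟩ := poincare_lemma 1 le_rfl β
    (locForm_injective hf0 (h2.symm.trans (map_zero _).symm))
  rw [hβ', ← extOp_locForm, ← map_add] at h1
  generalize degPart 0 η + locForm f β' = θ at h1
  have h3 : ∀ i, partialLoc f i (θ ∅) = logCoeff f i := fun i => by
    rw [← logForm_singleton, h1, extOp_singleton]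
    rfl
  have h4 : eulerOp (partialLoc f) (locX f) w (θ ∅) = algebraMap K _ (d : K) := by
    rw [eulerOp_apply, ← sum_locX_mul_logCoeff hf]
    simp only [h3]
  obtain ⟨k, α, hα⟩ := exists_eq_invLoc_pow_smul f θ
  rw [hα, Pi.smul_apply, smul_eq_mul, locForm_apply, eulerOp_invLoc_pow_mul hf] at h4
  have h5 : algebraMap _ (Localization.Away f) (f ^ k) * invLoc f ^ k = 1 := by
    rw [map_pow, ← mul_pow, algebraMap_mul_invLoc, one_pow]
  have h6 : eulerOp (pderiv (R := K)) X w (α ∅) - ((k * d : ℕ) : K) • α ∅ = (d : K) • f ^ k := by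
    refine algebraMap_loc_injective hf0 ?_
    rw [algebraMap_loc_smul, Algebra.smul_def (R := K) (A := Localization.Away f), ← h4]
    linear_combination (-algebraMap _ (Localization.Away f)
      (eulerOp (pderiv (R := K)) X w (α ∅) - ((k * d : ℕ) : K) • α ∅)) * h5
  -- Every monomial of `f ^ k` has weight `k * d`, and in that weight the left side of `h6` has
  -- coefficient zero.
  obtain ⟨m, hm⟩ := exists_coeff_ne_zero (pow_ne_zero k hf0)
  have h7 := congrArg (coeff m) h6
  have h8 : Finsupp.weight w m = k * d := by
    have := hf.pow k hm
    simpa using this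
  rw [coeff_sub, coeff_eulerOp, coeff_smul, coeff_smul, h8, smul_eq_mul, sub_self,
    smul_eq_mul] at h7
  exact mul_ne_zero (Nat.cast_ne_zero.2 hd.ne') hm h7.symm

end LogarithmicForm

/-! ### Functions on the complement with polynomial derivatives. -/

section Constants

open MvPolynomial

variable {K : Type*} [Field K] {n : ℕ}

theorem totalDegree_pderiv_lt (i : Fin n) (q : MvPolynomial (Fin n) K) (h : pderiv i q ≠ 0) :
    (pderiv i q).totalDegree < q.totalDegree := by
  have hlt : ∀ m ∈ (pderiv i q).support, (m.sum fun _ e => e) < q.totalDegree := by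
    intro m hm
    rw [mem_support_iff, coeff_pderiv] at hm
    have h1 := le_totalDegree (mem_support_iff.2 (left_ne_zero_of_mul hm))
    rw [Finsupp.sum_add_index' (fun _ => rfl) (fun _ _ _ => rfl),
      Finsupp.sum_single_index rfl] at h1
    omega
  obtain ⟨m, hm⟩ := support_nonempty.2 h
  exact (Finset.sup_lt_iff ((Nat.zero_le _).trans_lt (hlt m hm))).2 hlt

/-- A nonzero derivative has smaller total degree than `q`, so it cannot be a multiple of `q`. -/
theorem pderiv_eq_zero_of_dvd (i : Fin n) (q : MvPolynomial (Fin n) K) (hq : q ∣ pderiv i q) :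
    pderiv i q = 0 := by
  by_contra h
  have hlt := totalDegree_pderiv_lt i q h
  obtain ⟨s, hs⟩ := hq
  rw [hs] at h hlt
  rw [totalDegree_mul_of_isDomain (left_ne_zero_of_mul h) (right_ne_zero_of_mul h)] at hlt
  omega

theorem isDomain_localizationAway {f : MvPolynomial (Fin n) K} (hf0 : f ≠ 0) :
    IsDomain (Localization.Away f) :=
  IsLocalization.isDomain_localization (powers_le_nonZeroDivisors_of_noZeroDivisors hf0)

variable [CharZero K] {f : MvPolynomial (Fin n) K}

/-- The Euler operator with all weights one multiplies each coefficient by its total degree. -/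
theorem eq_C_of_pderiv_eq_zero (q : MvPolynomial (Fin n) K) (hq : ∀ i, pderiv i q = 0) :
    q = C (coeff 0 q) := by
  ext m
  rw [coeff_C]
  split_ifs with h
  · rw [h]
  · have h1 := coeff_eulerOp (fun _ => 1) m q
    rw [eulerOp_apply] at h1
    simp only [hq, mul_zero, smul_zero, Finset.sum_const_zero, coeff_zero] at h1
    refine (mul_eq_zero.1 h1.symm).resolve_left (Nat.cast_ne_zero.2 fun h2 => h ?_)
    ext i
    by_contra hne
    have := Finsupp.le_weight_of_ne_zero' (fun _ : Fin n => 1) (fun h => hne h.symm)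
    omega

/-- An element of `R_f` whose partial derivatives vanish comes from `R`. -/
theorem exists_algebraMap_of_partialLoc_eq_zero (hf0 : f ≠ 0) (s : Localization.Away f)
    (hs : ∀ i, partialLoc f i s = 0) : ∃ r, algebraMap (MvPolynomial (Fin n) K) _ r = s := by
  have := isDomain_localizationAway hf0
  have hinj := algebraMap_loc_injective hf0
  obtain ⟨⟨α, ⟨_, k, rfl⟩⟩, hα⟩ := IsLocalization.surj (Submonoid.powers f) s
  obtain ⟨q, p, c, hqp, hq, hp⟩ := UniqueFactorizationMonoid.exists_reduced_factors (f ^ k)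
    (pow_ne_zero k hf0) α
  simp only at hα
  rw [← hq, ← hp, map_mul, map_mul] at hα
  have hc : algebraMap _ (Localization.Away f) c ≠ 0 := fun h => by
    have h0 : c = 0 := hinj (h.trans (map_zero _).symm)
    rw [h0, zero_mul] at hq
    exact pow_ne_zero k hf0 hq.symm
  have h1 : s * algebraMap _ _ q = algebraMap _ _ p :=
    mul_left_cancel₀ hc (by linear_combination hα)
  -- For `s = p / q` in lowest terms, `∂ s = 0` gives `p ∂q = q ∂p`. Hence `q` divides `∂q`, which
  -- is therefore zero, and `q` is constant.
  have h2 : ∀ i, pderiv i q = 0 := fun i => by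
    refine pderiv_eq_zero_of_dvd i q (hqp.dvd_of_dvd_mul_left ⟨pderiv i p, hinj ?_⟩)
    have h3 := congrArg (partialLoc f i) h1
    rw [Derivation.leibniz, hs, partialLoc_algebraMap, partialLoc_algebraMap, smul_zero, add_zero,
      smul_eq_mul] at h3
    rw [map_mul, map_mul, ← h1, ← h3]
    ring
  have h4 := eq_C_of_pderiv_eq_zero q h2
  set c0 := coeff 0 q
  have hc0 : c0 ≠ 0 := fun h => by
    rw [h, C_0] at h4
    rw [h4, mul_zero] at hq
    exact pow_ne_zero k hf0 hq.symm
  refine ⟨C c0⁻¹ * p, ?_⟩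
  rw [map_mul, ← h1, h4, mul_left_comm, ← map_mul, ← C_mul, inv_mul_cancel₀ hc0, C_1, map_one,
    mul_one]

/-- An element of `R_f` whose partial derivatives come from `R` comes from `R`. -/
theorem exists_algebraMap_of_partialLoc (hf0 : f ≠ 0) (s : Localization.Away f)
    (hs : ∀ i, ∃ r, partialLoc f i s = algebraMap (MvPolynomial (Fin n) K) _ r) :
    ∃ r, algebraMap (MvPolynomial (Fin n) K) _ r = s := by
  choose b hb using hs
  set z : Finset (Fin n) → Localization.Away f := Pi.single ∅ s with hz
  set β : Finset (Fin n) → MvPolynomial (Fin n) K :=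
    extOp (smulOp _ _ b) (Pi.single ∅ 1) with hβ
  have hβ1 : degPart 1 β = β := by
    rw [hβ, ← extOp_degPart, degPart_zero_single]
  have h1 : extOp (derOp (partialLoc f)) z = locForm f β := by
    ext1 I
    rw [locForm_apply, hβ, extOp_apply, extOp_apply, map_sum]
    refine Finset.sum_congr rfl fun i _ => ?_
    split_ifs
    · rw [map_zsmul, smulOp_apply, derOp_apply, hz]
      by_cases hI : I.erase i = ∅
      · rw [hI, Pi.single_eq_same, Pi.single_eq_same, hb, smul_eq_mul, mul_one]
      · rw [Pi.single_eq_of_ne hI, Pi.single_eq_of_ne hI, map_zero, zsmul_zero,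
          smul_zero, map_zero, zsmul_zero]
    · rw [map_zero]
  have h2 := congrArg (extOp (derOp (partialLoc f))) h1
  rw [extOp_derOp_derOp _ (partialLoc_comm f), extOp_locForm] at h2
  -- The polynomial form `β = ds` is closed, hence `dη` with `η` polynomial; then `s - η` has
  -- vanishing derivatives.
  obtain ⟨η, hη⟩ := poincare_lemma 1 le_rfl β (by
    rw [hβ1]
    exact locForm_injective hf0 (h2.symm.trans (map_zero _).symm))
  rw [hβ1] at hη
  obtain ⟨r, hr⟩ := exists_algebraMap_of_partialLoc_eq_zero hf0
    (s - algebraMap _ _ (η ∅)) (fun i => by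
      have h3 := congrFun h1 {i}
      rw [extOp_singleton, hη, locForm_apply, extOp_singleton, derOp_apply, derOp_apply, hz,
        Pi.single_eq_same] at h3
      rw [map_sub, h3, partialLoc_algebraMap, sub_self])
  exact ⟨r + η ∅, by rw [map_add, hr, sub_add_cancel]⟩

end Constants

/-! ### The case of one variable. -/

section OneVariable

open MvPolynomial

variable {K : Type*} [Field K] [CharZero K] {f : MvPolynomial (Fin 1) K} {w : Fin 1 → ℕ} {d : ℕ}

/-- In one variable `df / f` spans the first cohomology. -/
theorem exists_eq_logForm_add_one (hf0 : f ≠ 0) (hw : ∀ i, 0 < w i) (hd : 0 < d)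
    (hf : IsWeightedHomogeneous w f d)
    (ω : Finset (Fin 1) → Localization.Away f) (hωp : degPart 1 ω = ω) :
    ∃ (c : K) (η : _), ω = c • logForm f + extOp (derOp (partialLoc f)) η := by
  have := isDomain_localizationAway hf0
  let W : Submodule K (Finset (Fin 1) → Localization.Away f) :=
    { carrier := {ω | ∃ (c : K) (η : _), ω = c • logForm f + extOp (derOp (partialLoc f)) η}
      zero_mem' := ⟨0, 0, by simp⟩
      add_mem' := by
        rintro _ _ ⟨c, η, rfl⟩ ⟨c', η', rfl⟩
        exact ⟨c + c', η + η', by rw [map_add, add_smul]; abel⟩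
      smul_mem' := by
        rintro a _ ⟨c, η, rfl⟩
        exact ⟨a * c, a • η, by rw [extOp_derOp_smul_field, smul_add, smul_smul]⟩ }
  change ω ∈ W
  obtain ⟨k, α, hα⟩ := exists_eq_invLoc_pow_smul f ω
  have hsets : ∀ I : Finset (Fin 1), I.card = 1 → I = {0} := by decide
  have hω : ω = invLoc f ^ k • locForm f (Pi.single {0} (α {0})) := by
    rw [← hωp, hα, degPart_smul, ← locForm_degPart]
    congr 2
    ext1 I
    rw [degPart]
    split_ifs with hI
    · rw [hsets I hI, Pi.single_eq_same]
    · rw [Pi.single_eq_of_ne]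
      rintro rfl
      exact hI (Finset.card_singleton 0)
  have hsum : Pi.single {0} (α {0}) = ∑ m ∈ (α {0}).support,
      (Pi.single {0} (monomial m (coeff m (α {0}))) :
        Finset (Fin 1) → MvPolynomial (Fin 1) K) := by
    conv_lhs => rw [(α {0}).as_sum]
    exact map_sum (AddMonoidHom.single
      (fun _ : Finset (Fin 1) => MvPolynomial (Fin 1) K) {0}) _ _
  rw [hω, hsum, map_sum, Finset.smul_sum]
  refine Submodule.sum_mem _ fun m _ => ?_
  generalize coeff m (α {0}) = c
  set τ : Finset (Fin 1) → Localization.Away f :=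
    invLoc f ^ k • locForm f (Pi.single {0} (monomial m c)) with hτ
  have hτ0 : ∀ I, I ≠ {0} → τ I = 0 := fun I hI => by
    rw [hτ, Pi.smul_apply, locForm_apply, Pi.single_eq_of_ne hI, map_zero, smul_zero]
  -- The term `X^m dx / f ^ k` has weight `weight m + w 0 - k * d`. If this is zero, `f ^ k` is a
  -- scalar multiple of `X^(m + 1)` and the term is a multiple of `dx / x`.
  by_cases hwt : Finsupp.weight w m + w 0 = k * d
  · have hfw : ∀ v : Fin 1 →₀ ℕ, Finsupp.weight w v = v 0 * w 0 := fun v => by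
      rw [Finsupp.weight_apply, Finsupp.sum_fintype _ _ (by simp)]
      simp
    have hweight : ∀ u : Fin 1 →₀ ℕ, Finsupp.weight w u = k * d → u = m + Finsupp.single 0 1 := by
      intro u hu
      ext
      rw [← hwt] at hu
      rw [hfw, hfw] at hu
      have : u 0 * w 0 = (m 0 + 1) * w 0 := by rw [hu]; ring
      simpa using Nat.eq_of_mul_eq_mul_right (hw 0) this
    obtain ⟨u, hu⟩ := exists_coeff_ne_zero (pow_ne_zero k hf0)
    have hpow : f ^ k = monomial (m + Finsupp.single 0 1) (coeff u (f ^ k)) := by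
      ext v
      rw [coeff_monomial]
      have hk : ∀ v, coeff v (f ^ k) ≠ 0 → v = m + Finsupp.single 0 1 := fun v hv =>
        hweight v (by simpa using hf.pow k hv)
      split_ifs with hv
      · rw [← hv, ← hk u hu]
      · by_contra hne
        exact hv (hk v hne).symm
    set c0 := coeff u (f ^ k)
    have hd0 : (d : K) ≠ 0 := Nat.cast_ne_zero.2 hd.ne'
    have h1 : locX f 0 * τ {0} = algebraMap K _ (c / c0) := by
      have h2 : X 0 * monomial m c = (c / c0) • f ^ k := by
        rw [hpow, smul_monomial, X, monomial_mul, one_mul, add_comm, smul_eq_mul,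
          div_mul_cancel₀ _ hu]
      have h3 := congrArg (algebraMap _ (Localization.Away f)) h2
      rw [map_mul, algebraMap_loc_smul, Algebra.smul_def] at h3
      have h5 : algebraMap _ (Localization.Away f) (f ^ k) * invLoc f ^ k = 1 := by
        rw [map_pow, ← mul_pow, algebraMap_mul_invLoc, one_pow]
      rw [hτ, Pi.smul_apply, locForm_apply, Pi.single_eq_same, smul_eq_mul, locX]
      linear_combination invLoc f ^ k * h3 + algebraMap K _ (c / c0) * h5
    have h2 : (w 0 : K) • (locX f 0 * logCoeff f 0) = algebraMap K _ (d : K) := by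
      have := sum_locX_mul_logCoeff hf
      simpa using this
    have hX : locX f 0 ≠ 0 := fun h => by
      rw [h, zero_mul, smul_zero] at h2
      exact (map_ne_zero_iff _ (algebraMap K (Localization.Away f)).injective).2 hd0 h2.symm
    -- Compare `x τ = c / c0` with `w 0 x f' / f = d`.
    refine ⟨c / c0 * (w 0 / d), 0, ?_⟩
    rw [map_zero, add_zero]
    ext1 I
    by_cases hI : I = {0}
    · subst hI
      rw [Pi.smul_apply, logForm_singleton]
      refine mul_left_cancel₀ hX ?_
      rw [h1, mul_smul_comm, mul_div_assoc', mul_div_right_comm, mul_smul, h2,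
        Algebra.smul_def, ← map_mul, div_mul_cancel₀ _ hd0]
    · rw [hτ0 I hI, Pi.smul_apply, ← degPart_logForm, degPart,
        if_neg (fun h => hI (hsets I h)), smul_zero]
  · have hclosed : extOp (derOp (partialLoc f)) τ = 0 := by
      ext1 I
      rw [extOp_apply]
      refine Finset.sum_eq_zero fun i _ => ?_
      split_ifs
      · rw [hτ0, map_zero, zsmul_zero]
        intro h
        have := Finset.notMem_erase i I
        rw [h, Subsingleton.elim i 0] at this
        exact this (Finset.mem_singleton_self 0)
      · rfl
    have hmem : τ ∈ nonzeroPart (lieOp (partialLoc f) (locX f) w) := by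
      refine mem_nonzeroPart_of_eigenvector _
        (c := (Finsupp.weight w m : K) + w 0 - (k * d : ℕ)) ?_ ?_
      · rw [sub_ne_zero]
        exact_mod_cast hwt
      · ext1 I
        rw [lieOp_apply, Pi.smul_apply]
        by_cases hI : I = {0}
        · subst hI
          rw [hτ, Pi.smul_apply, locForm_apply, Pi.single_eq_same, smul_eq_mul,
            eulerOp_invLoc_pow_mul hf, eulerOp_monomial, setWeight, Finset.sum_singleton,
            ← sub_smul, algebraMap_loc_smul]
          simp only [Algebra.smul_def, map_sub, map_add]
          ring
        · rw [hτ0 I hI, map_zero, smul_zero, smul_zero, add_zero]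
    obtain ⟨η, hη⟩ := exists_extOp_of_mem_nonzeroPart _ (partialLoc_comm f) (locX f)
      partialLoc_locX w _ hclosed hmem
    exact ⟨0, η, by rw [zero_smul, zero_add, hη]⟩

end OneVariable

/-! ### Passage from `R_f` to `R_f / R`. -/

section Descent

open MvPolynomial

variable {K : Type*} [Field K] {n : ℕ} (f : MvPolynomial (Fin n) K)

/-- The operators `∂_i` on `R_f / R`, as additive maps. -/
noncomputable def partialAdd (i : Fin n) : LocalCohomologyOne f →+ LocalCohomologyOne f :=
  (partialOp f i).toAddMonoidHom

/-- The map from forms over `R_f` to forms over `R_f / R`. -/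
noncomputable def quotForm :
    (Finset (Fin n) → Localization.Away f) →ₗ[K] (Finset (Fin n) → LocalCohomologyOne f) :=
  (imageInLoc f).mkQ.compLeft _

theorem quotForm_apply (ω : Finset (Fin n) → Localization.Away f) (I : Finset (Fin n)) :
    quotForm f ω I = (imageInLoc f).mkQ (ω I) := rfl

theorem extOp_quotForm (ω : Finset (Fin n) → Localization.Away f) :
    extOp (partialAdd f) (quotForm f ω) = quotForm f (extOp (derOp (partialLoc f)) ω) :=
  extOp_comp (derOp (partialLoc f)) (partialAdd f) (imageInLoc f).mkQ.toAddMonoidHom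
    (imageInLoc f).mkQ.toAddMonoidHom (fun _ _ => rfl) ω

theorem quotForm_degPart (p : ℕ) (ω : Finset (Fin n) → Localization.Away f) :
    quotForm f (degPart p ω) = degPart p (quotForm f ω) := by
  ext1 I
  simp only [quotForm_apply, degPart]
  split_ifs
  · rfl
  · exact map_zero _

theorem quotForm_eq_zero_iff (ω : Finset (Fin n) → Localization.Away f) :
    quotForm f ω = 0 ↔ ∃ β, locForm f β = ω := by
  constructor
  · intro h
    have h1 : ∀ I, ∃ r, algebraMap (MvPolynomial (Fin n) K) (Localization.Away f) r = ω I :=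
      fun I => (Submodule.Quotient.mk_eq_zero _).1 (congrFun h I)
    choose β hβ using h1
    exact ⟨β, funext hβ⟩
  · rintro ⟨β, rfl⟩
    ext1 I
    exact (Submodule.Quotient.mk_eq_zero _).2 ⟨β I, rfl⟩

theorem quotForm_surjective : Function.Surjective (quotForm f) := fun z => by
  choose ω hω using fun I => (imageInLoc f).mkQ_surjective (z I)
  exact ⟨ω, funext hω⟩

variable [CharZero K] {f}

/-- Closed forms over `R_f / R` lift to closed forms over `R_f`. -/
theorem exists_closed_lift (hf0 : f ≠ 0) {p : ℕ} (z : Finset (Fin n) → LocalCohomologyOne f)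
    (hzp : degPart p z = z) (hz : extOp (partialAdd f) z = 0) :
    ∃ ω, quotForm f ω = z ∧ degPart p ω = ω ∧ extOp (derOp (partialLoc f)) ω = 0 := by
  obtain ⟨ω, rfl⟩ := quotForm_surjective f z
  rw [extOp_quotForm] at hz
  obtain ⟨β, hβ⟩ := (quotForm_eq_zero_iff f _).1 hz
  have h1 : extOp (derOp (partialLoc f)) (degPart p ω) = locForm f (degPart (p + 1) β) := by
    rw [extOp_degPart, ← hβ, locForm_degPart]
  have h2 := congrArg (extOp (derOp (partialLoc f))) h1
  rw [extOp_derOp_derOp _ (partialLoc_comm f), extOp_locForm] at h2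
  -- The differential of a lift is a closed polynomial form of positive degree; subtracting a
  -- polynomial primitive makes the lift closed.
  obtain ⟨η, hη⟩ := poincare_lemma (p + 1) (by omega) β
    (locForm_injective hf0 (h2.symm.trans (map_zero _).symm))
  refine ⟨degPart p ω - locForm f (degPart p η), ?_, ?_, ?_⟩
  · rw [map_sub, (quotForm_eq_zero_iff f _).2 ⟨_, rfl⟩, sub_zero, quotForm_degPart, hzp]
  · ext1 I
    simp only [degPart, Pi.sub_apply, locForm_apply]
    split_ifs <;> simp
  · rw [map_sub, h1, extOp_locForm, extOp_degPart, ← hη, degPart_degPart, sub_self]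

/-- A lift to `R_f` has all its partial derivatives in `R`, so it lies in `R`. -/
theorem eq_zero_of_extOp_partialAdd (hf0 : f ≠ 0) (z : Finset (Fin n) → LocalCohomologyOne f)
    (hzp : degPart 0 z = z) (hz : extOp (partialAdd f) z = 0) : z = 0 := by
  obtain ⟨s, hs⟩ := (imageInLoc f).mkQ_surjective (z ∅)
  have h1 : ∃ r, algebraMap (MvPolynomial (Fin n) K) _ r = s := by
    refine exists_algebraMap_of_partialLoc hf0 s fun i => ?_
    have h2 := congrFun hz {i}
    rw [extOp_singleton, ← hs] at h2
    obtain ⟨r, hr⟩ := (Submodule.Quotient.mk_eq_zero _).1 h2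
    exact ⟨r, hr.symm⟩
  have h2 : z ∅ = 0 := by
    rw [← hs]
    exact (Submodule.Quotient.mk_eq_zero _).2 h1
  rw [← hzp]
  ext1 I
  rw [degPart]
  split_ifs with hI
  · rw [Finset.card_eq_zero.1 hI, h2]
    rfl
  · rfl

theorem KoszulExact.exists_primitive_quot (hK : KoszulExact f) (hf0 : f ≠ 0) {w : Fin n → ℕ}
    {d : ℕ} (hw : ∀ i, 0 < w i) (hf : IsWeightedHomogeneous w f d) {p : ℕ} (hp2 : 2 ≤ p)
    (hp : p + 2 ≤ n) (z : Finset (Fin n) → LocalCohomologyOne f) (hzp : degPart p z = z)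
    (hz : extOp (partialAdd f) z = 0) : ∃ y, z = extOp (partialAdd f) y := by
  obtain ⟨ω, rfl, hωp, hω⟩ := exists_closed_lift hf0 z hzp hz
  obtain ⟨η, hη⟩ := hK.exists_primitive hf0 hw hf hp2 hp ω hωp hω
  exact ⟨quotForm f η, by rw [extOp_quotForm, ← hη]⟩

theorem KoszulExact.exists_eq_quot_logForm_add (hK : KoszulExact f) (hf0 : f ≠ 0)
    {w : Fin n → ℕ} {d : ℕ} (hw : ∀ i, 0 < w i) (hd : 0 < d) (hf : IsWeightedHomogeneous w f d)
    (hn : n ≠ 2) (z : Finset (Fin n) → LocalCohomologyOne f) (hzp : degPart 1 z = z)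
    (hz : extOp (partialAdd f) z = 0) :
    ∃ (c : K) (y : _), z = c • quotForm f (logForm f) + extOp (partialAdd f) y := by
  obtain ⟨ω, rfl, hωp, hω⟩ := exists_closed_lift hf0 z hzp hz
  have h1 : ∃ (c : K) (η : _), ω = c • logForm f + extOp (derOp (partialLoc f)) η := by
    -- Without variables `f` would have degree zero. One variable is treated directly, and from
    -- three on degree one lies in the range of pole reduction.
    rcases n with _ | _ | n
    · obtain ⟨m, hm⟩ := exists_coeff_ne_zero hf0
      have h2 := hf hm
      rw [Subsingleton.elim m 0, map_zero] at h2
      omega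
    · exact exists_eq_logForm_add_one hf0 hw hd hf ω hωp
    · exact hK.exists_eq_logForm_add hf0 hw hf (by omega) ω hωp hω
  obtain ⟨c, η, h2⟩ := h1
  exact ⟨c, quotForm f η, by rw [extOp_quotForm, ← map_smul, ← map_add, ← h2]⟩

theorem extOp_quot_logForm : extOp (partialAdd f) (quotForm f (logForm f)) = 0 := by
  rw [extOp_quotForm, extOp_logForm, map_zero]

theorem quot_logForm_ne (hf0 : f ≠ 0) {w : Fin n → ℕ} {d : ℕ} (hd : 0 < d)
    (hf : IsWeightedHomogeneous w f d) (y : Finset (Fin n) → LocalCohomologyOne f) :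
    quotForm f (logForm f) ≠ extOp (partialAdd f) y := by
  intro h
  obtain ⟨η, rfl⟩ := quotForm_surjective f y
  rw [extOp_quotForm, ← sub_eq_zero, ← map_sub] at h
  obtain ⟨β, hβ⟩ := (quotForm_eq_zero_iff f _).1 h
  exact logForm_ne_extOp_add hf0 hd hf η β (by rw [hβ]; abel)

end Descent

/-! ### Comparison with the graded terms of the two complexes. -/

section Comparison

variable {K : Type*} [Field K] {M : Type*} [AddCommGroup M] [Module K M] {n : ℕ}

/-- Extension by zero of a form of degree `p`. -/
def toTotal {p : ℕ} (ω : Forms M n p) : Finset (Fin n) → M :=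
  fun I => if h : I.card = p then ω ⟨I, h⟩ else 0

/-- The component of degree `p`. -/
def ofTotal (p : ℕ) (z : Finset (Fin n) → M) : Forms M n p := fun I => z I.1

theorem ofTotal_toTotal {p : ℕ} (ω : Forms M n p) : ofTotal p (toTotal ω) = ω :=
  funext fun I => dif_pos I.2

theorem toTotal_ofTotal {p : ℕ} (z : Finset (Fin n) → M) :
    toTotal (ofTotal p z) = degPart p z := rfl

theorem degPart_toTotal {p : ℕ} (ω : Forms M n p) : degPart p (toTotal ω) = toTotal ω := by
  rw [← toTotal_ofTotal, ofTotal_toTotal]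

theorem neg_one_pow_smul_eq (k : ℕ) (m : M) : (-1 : K) ^ k • m = (-1 : ℤ) ^ k • m := by
  rcases neg_one_pow_eq_or K k with h | h <;> rcases Nat.even_or_odd k with h' | h' <;>
    simp [h'.neg_one_pow]

variable (D : Fin n → Module.End K M)

/-- Linear operators as additive maps. -/
def endAdd (i : Fin n) : M →+ M := (D i).toAddMonoidHom

theorem deRhamD_ofTotal (p : ℕ) (z : Finset (Fin n) → M) :
    deRhamD D p (ofTotal p z) = ofTotal (p + 1) (extOp (endAdd D) z) := by
  ext I
  change _ = extOp (endAdd D) z I.1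
  rw [extOp_apply, ← Finset.sum_filter,
    Finset.sum_subtype _ (p := fun i => i ∈ I.1) (fun i => by simp)]
  exact Finset.sum_congr rfl fun i _ => neg_one_pow_smul_eq (K := K) (M := M) _ _

theorem koszulD_ofTotal (p : ℕ) (z : Finset (Fin n) → M) :
    koszulD D p (ofTotal (p + 1) z) = ofTotal p (intOp (endAdd D) z) := by
  ext I
  change _ = intOp (endAdd D) z I.1
  have h : ∀ i, (if i ∈ I.1 then 0 else (-1 : ℤ) ^ numBelow I.1 i •
      endAdd D i (z (insert i I.1))) =
      if i ∉ I.1 then (-1 : ℤ) ^ numBelow I.1 i • endAdd D i (z (insert i I.1)) else 0 :=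
    fun i => (ite_not _ _ _).symm
  rw [intOp_apply, Finset.sum_congr rfl fun i _ => h i, ← Finset.sum_filter,
    Finset.sum_subtype _ (p := fun i => i ∉ I.1) (fun i => by simp)]
  simp only [koszulD, LinearMap.coe_mk, AddHom.coe_mk]
  exact Fintype.sum_equiv (Equiv.refl _) _ _ fun i => neg_one_pow_smul_eq (K := K) (M := M) _ _

theorem extOp_toTotal {p : ℕ} (ω : Forms M n p) :
    extOp (endAdd D) (toTotal ω) = toTotal (deRhamD D p ω) := by
  conv_rhs => rw [← ofTotal_toTotal ω, deRhamD_ofTotal, toTotal_ofTotal, ← extOp_degPart,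
    degPart_toTotal]

theorem intOp_degPart {N : Type*} [AddCommGroup N] (φ : Fin n → M →+ N) (p : ℕ)
    (ω : Finset (Fin n) → M) : intOp φ (degPart (p + 1) ω) = degPart p (intOp φ ω) := by
  ext1 I
  simp only [intOp_apply, degPart]
  split_ifs with h
  · refine Finset.sum_congr rfl fun i _ => ?_
    split_ifs with hi h2
    · rfl
    · rfl
    · exact absurd (by rw [Finset.card_insert_of_notMem hi, h]) h2
  · refine Finset.sum_eq_zero fun i _ => ?_
    split_ifs with hi h2
    · rfl
    · rw [Finset.card_insert_of_notMem hi] at h2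
      omega
    · rw [map_zero, zsmul_zero]

theorem intOp_degPart_zero {N : Type*} [AddCommGroup N] (φ : Fin n → M →+ N)
    (ω : Finset (Fin n) → M) : intOp φ (degPart 0 ω) = 0 := by
  ext1 I
  rw [intOp_apply]
  refine Finset.sum_eq_zero fun i _ => ?_
  split_ifs with hi
  · rfl
  · rw [degPart, if_neg (by rw [Finset.card_insert_of_notMem hi]; omega), map_zero, zsmul_zero]

theorem intOp_toTotal {p : ℕ} (ω : Forms M n (p + 1)) :
    intOp (endAdd D) (toTotal ω) = toTotal (koszulD D p ω) := by
  conv_rhs => rw [← ofTotal_toTotal ω, koszulD_ofTotal, toTotal_ofTotal, ← intOp_degPart,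
    degPart_toTotal]

theorem intOp_toTotal_zero (ω : Forms M n 0) : intOp (endAdd D) (toTotal ω) = 0 := by
  rw [← degPart_toTotal, intOp_degPart_zero]

theorem complStar_degPart {p q : ℕ} (h : p + q = n) (ω : Finset (Fin n) → M) :
    complStar (degPart p ω) = degPart q (complStar ω) := by
  ext1 I
  have h1 : I.card + Iᶜ.card = n := by rw [Finset.card_add_card_compl, Fintype.card_fin]
  simp only [complStar, degPart]
  split_ifs with h2 h3 h3
  · rfl
  · omega
  · omega
  · exact zsmul_zero _

/-- A closed form for the Koszul differential is the star of a closed form for the exterior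
derivative. -/
theorem exists_complStar_eq {p q : ℕ} (h : p + q = n) (ξ : Forms M n q)
    (hξ : intOp (endAdd D) (toTotal ξ) = 0) :
    ∃ ω, complStar ω = toTotal ξ ∧ degPart p ω = ω ∧ extOp (endAdd D) ω = 0 := by
  obtain ⟨ω, hω⟩ := complStar_bijective.2 (toTotal ξ)
  have h0 : complStar (0 : Finset (Fin n) → M) = 0 := by
    ext1 I
    exact zsmul_zero _
  refine ⟨ω, hω, complStar_bijective.1 ?_, complStar_bijective.1 ?_⟩
  · rw [complStar_degPart h, hω, degPart_toTotal]
  · rw [complStar_extOp, hω, hξ, h0]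

end Comparison

/-! ### Homology of short complexes of vector spaces. -/

section Homology

universe v u

variable {K : Type u} [Field K]

theorem isZero_homology_of_exact (S : ShortComplex (ModuleCat.{v} K))
    (h : ∀ x, S.g x = 0 → ∃ y, S.f y = x) : Limits.IsZero S.homology :=
  (ShortComplex.exact_iff_isZero_homology S).1 ((ShortComplex.moduleCat_exact_iff S).2 h)

theorem nonempty_homology_iso (S : ShortComplex (ModuleCat.{u} K)) (x₀ : S.X₂)
    (hx₀ : S.g x₀ = 0) (hne : ∀ y, S.f y ≠ x₀)
    (h : ∀ x, S.g x = 0 → ∃ (c : K) (y : S.X₁), x = c • x₀ + S.f y) :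
    Nonempty (S.homology ≅ ModuleCat.of K K) := by
  -- The class of `x₀` is nonzero by `hne` and spans by `h`, so scalars times this class give the
  -- isomorphism.
  let T : K →ₗ[K] (LinearMap.ker S.g.hom ⧸ LinearMap.range S.moduleCatToCycles) :=
    (LinearMap.range S.moduleCatToCycles).mkQ ∘ₗ
      LinearMap.toSpanSingleton K (LinearMap.ker S.g.hom) ⟨x₀, hx₀⟩
  have hT : Function.Bijective T := by
    constructor
    · rw [← LinearMap.ker_eq_bot, LinearMap.ker_eq_bot']
      intro c hc
      by_contra hc0
      obtain ⟨y, hy⟩ := (Submodule.Quotient.mk_eq_zero _).1 hc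
      refine hne (c⁻¹ • y) ?_
      have hy' : S.f y = c • x₀ := congrArg Subtype.val hy
      rw [map_smul, hy', inv_smul_smul₀ hc0]
    · intro q
      obtain ⟨⟨x, hx⟩, rfl⟩ := Submodule.Quotient.mk_surjective _ q
      obtain ⟨c, y, hcy⟩ := h x hx
      refine ⟨c, (Submodule.Quotient.eq _).2 ⟨-y, Subtype.ext ?_⟩⟩
      change S.f (-y) = c • x₀ - x
      rw [map_neg, hcy]
      abel
  exact ⟨S.moduleCatHomologyIso ≪≫ (LinearEquiv.ofBijective T hT).symm.toModuleIso⟩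

end Homology

/-! ### Homology of the de Rham and Koszul complexes. -/

section Complexes

universe u

variable {K M : Type u} [Field K] [AddCommGroup M] [Module K M] {n : ℕ}
  (D : Fin n → Module.End K M) (hD : ∀ i j, Commute (D i) (D j))

theorem deRhamComplex_d (p : ℕ) :
    (deRhamComplex D hD).d p (p + 1) = ModuleCat.ofHom (deRhamD D p) :=
  CochainComplex.of_d (fun p => ModuleCat.of K (Forms M n p))
    (fun p => ModuleCat.ofHom (deRhamD D p)) p

theorem koszulComplex_d (p : ℕ) :
    (koszulComplex D hD).d (p + 1) p = ModuleCat.ofHom (koszulD D p) :=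
  ChainComplex.of_d (fun p => ModuleCat.of K (Forms M n p))
    (fun p => ModuleCat.ofHom (koszulD D p)) p

theorem ext_of_toTotal {p : ℕ} {ω η : Forms M n p} (h : toTotal ω = toTotal η) : ω = η := by
  rw [← ofTotal_toTotal ω, h, ofTotal_toTotal]

theorem toTotal_zero {p : ℕ} : toTotal (0 : Forms M n p) = 0 := by
  ext I
  rw [toTotal]
  split_ifs <;> rfl

theorem deRhamComplex_d_apply (p : ℕ) (y : Forms M n p) :
    (deRhamComplex D hD).d p (p + 1) y = deRhamD D p y := by
  rw [deRhamComplex_d]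
  rfl

theorem extOp_toTotal_eq_zero {p : ℕ} {x : Forms M n p} (hx : deRhamD D p x = 0) :
    extOp (endAdd D) (toTotal x) = 0 := by
  rw [extOp_toTotal, hx, toTotal_zero]

theorem isZero_deRhamComplex_homology_zero
    (h : ∀ z : Finset (Fin n) → M, degPart 0 z = z → extOp (endAdd D) z = 0 → z = 0) :
    Limits.IsZero ((deRhamComplex D hD).homology 0) := by
  have key : ∀ x : Forms M n 0, deRhamD D 0 x = 0 → x = 0 := fun x hx =>
    ext_of_toTotal ((h _ (degPart_toTotal _) (extOp_toTotal_eq_zero D hx)).trans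
      toTotal_zero.symm)
  -- At the left end the predecessor of `0` is by convention `0` itself, with zero differential;
  -- exactness there means injectivity of the next map.
  refine (isZero_homology_of_exact ((deRhamComplex D hD).sc' 0 0 1) fun x hx => ?_).of_iso
    (ShortComplex.homologyMapIso ((deRhamComplex D hD).isoSc' 0 0 1 (by simp) (by simp)))
  exact ⟨0, (map_zero _).trans (key x ((deRhamComplex_d_apply D hD 0 x).symm.trans hx)).symm⟩

theorem isZero_deRhamComplex_homology_succ (p : ℕ)
    (h : ∀ z : Finset (Fin n) → M, degPart (p + 1) z = z → extOp (endAdd D) z = 0 →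
      ∃ y, z = extOp (endAdd D) y) :
    Limits.IsZero ((deRhamComplex D hD).homology (p + 1)) := by
  have key : ∀ x : Forms M n (p + 1), deRhamD D (p + 1) x = 0 →
      ∃ y : Forms M n p, deRhamD D p y = x := fun x hx => by
    obtain ⟨y, hy⟩ := h (toTotal x) (degPart_toTotal _) (extOp_toTotal_eq_zero D hx)
    exact ⟨ofTotal p y, by rw [deRhamD_ofTotal, ← hy, ofTotal_toTotal]⟩
  refine (isZero_homology_of_exact ((deRhamComplex D hD).sc' p (p + 1) (p + 1 + 1))
    fun x hx => ?_).of_iso (ShortComplex.homologyMapIso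
      ((deRhamComplex D hD).isoSc' p (p + 1) (p + 1 + 1) (by simp) (by simp)))
  obtain ⟨y, hy⟩ := key x ((deRhamComplex_d_apply D hD (p + 1) x).symm.trans hx)
  exact ⟨y, (deRhamComplex_d_apply D hD p y).trans hy⟩

theorem nonempty_deRhamComplex_homology_succ_iso (p : ℕ) (z₀ : Finset (Fin n) → M)
    (hz₀ : degPart (p + 1) z₀ = z₀) (hdz₀ : extOp (endAdd D) z₀ = 0)
    (hne : ∀ y, z₀ ≠ extOp (endAdd D) y)
    (h : ∀ z : Finset (Fin n) → M, degPart (p + 1) z = z → extOp (endAdd D) z = 0 →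
      ∃ (c : K) (y : _), z = c • z₀ + extOp (endAdd D) y) :
    Nonempty ((deRhamComplex D hD).homology (p + 1) ≅ ModuleCat.of K K) := by
  have key0 : deRhamD D (p + 1) (ofTotal (p + 1) z₀) = 0 := by
    rw [deRhamD_ofTotal, hdz₀]
    rfl
  have key1 : ∀ y : Forms M n p, deRhamD D p y ≠ ofTotal (p + 1) z₀ := fun y hy =>
    hne (toTotal y) (by rw [extOp_toTotal, hy, toTotal_ofTotal, hz₀])
  have key : ∀ x : Forms M n (p + 1), deRhamD D (p + 1) x = 0 →
      ∃ (c : K) (y : Forms M n p), x = c • ofTotal (p + 1) z₀ + deRhamD D p y := fun x hx => by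
    obtain ⟨c, y, hcy⟩ := h (toTotal x) (degPart_toTotal _) (extOp_toTotal_eq_zero D hx)
    refine ⟨c, ofTotal p y, ?_⟩
    rw [deRhamD_ofTotal, ← ofTotal_toTotal x, hcy]
    rfl
  obtain ⟨e⟩ := nonempty_homology_iso ((deRhamComplex D hD).sc' p (p + 1) (p + 1 + 1))
    (ofTotal (p + 1) z₀) ((deRhamComplex_d_apply D hD _ _).trans key0)
    (fun y hy => key1 y ((deRhamComplex_d_apply D hD _ _).symm.trans hy)) (fun x hx => by
      obtain ⟨c, y, hcy⟩ := key x ((deRhamComplex_d_apply D hD _ _).symm.trans hx)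
      exact ⟨c, y, hcy.trans (congrArg (fun t => c • ofTotal (p + 1) z₀ + t)
        (deRhamComplex_d_apply D hD p y).symm)⟩)
  exact ⟨ShortComplex.homologyMapIso
    ((deRhamComplex D hD).isoSc' p (p + 1) (p + 1 + 1) (by simp) (by simp)) ≪≫ e⟩

theorem complStar_smul (c : K) (ω : Finset (Fin n) → M) :
    complStar (c • ω) = c • complStar ω := by
  ext1 I
  exact smul_comm _ _ _

theorem complStar_add (ω η : Finset (Fin n) → M) :
    complStar (ω + η) = complStar ω + complStar η := by
  ext1 I
  exact smul_add _ _ _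

theorem koszulComplex_d_apply (q : ℕ) (y : Forms M n (q + 1)) :
    (koszulComplex D hD).d (q + 1) q y = koszulD D q y := by
  rw [koszulComplex_d]
  rfl

/-- In degree zero the complex imposes no condition, and contraction kills every form. -/
theorem intOp_toTotal_eq_zero_of_next {q : ℕ} (x : Forms M n q)
    (hx : (koszulComplex D hD).d q ((ComplexShape.down ℕ).next q) x = 0) :
    intOp (endAdd D) (toTotal x) = 0 := by
  cases q with
  | zero => exact intOp_toTotal_zero D x
  | succ q =>
    rw [ChainComplex.next_nat_succ] at hx
    have hx' : koszulD D q x = 0 := (koszulComplex_d_apply D hD q x).symm.trans hx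
    rw [intOp_toTotal, hx', toTotal_zero]

/-- The star operator carries the de Rham complex in degree `p` to the Koszul complex in degree `n -
p`. -/
theorem isZero_koszulComplex_homology {p q : ℕ} (hpq : p + q = n)
    (h : ∀ z : Finset (Fin n) → M, degPart p z = z → extOp (endAdd D) z = 0 →
      ∃ y, z = extOp (endAdd D) y) :
    Limits.IsZero ((koszulComplex D hD).homology q) := by
  have key : ∀ x : Forms M n q, intOp (endAdd D) (toTotal x) = 0 →
      ∃ y : Forms M n (q + 1), koszulD D q y = x := fun x hx => by
    obtain ⟨ω, hω, hωp, hdω⟩ := exists_complStar_eq D hpq x hx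
    obtain ⟨y, hy⟩ := h ω hωp hdω
    exact ⟨ofTotal (q + 1) (complStar y), by
      rw [koszulD_ofTotal, ← complStar_extOp, ← hy, hω, ofTotal_toTotal]⟩
  refine (isZero_homology_of_exact ((koszulComplex D hD).sc' (q + 1) q _)
    fun x hx => ?_).of_iso (ShortComplex.homologyMapIso
      ((koszulComplex D hD).isoSc' (q + 1) q _ (by simp) rfl))
  obtain ⟨y, hy⟩ := key x (intOp_toTotal_eq_zero_of_next D hD x hx)
  exact ⟨y, (koszulComplex_d_apply D hD q y).trans hy⟩

theorem nonempty_koszulComplex_homology_iso {p q : ℕ} (hpq : p + q = n)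
    (z₀ : Finset (Fin n) → M)
    (hz₀ : degPart p z₀ = z₀) (hdz₀ : extOp (endAdd D) z₀ = 0)
    (hne : ∀ y, z₀ ≠ extOp (endAdd D) y)
    (h : ∀ z : Finset (Fin n) → M, degPart p z = z → extOp (endAdd D) z = 0 →
      ∃ (c : K) (y : _), z = c • z₀ + extOp (endAdd D) y) :
    Nonempty ((koszulComplex D hD).homology q ≅ ModuleCat.of K K) := by
  set x₀ : Forms M n q := ofTotal q (complStar z₀) with hx₀
  have key0 : (koszulComplex D hD).d q ((ComplexShape.down ℕ).next q) x₀ = 0 := by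
    cases q with
    | zero =>
      rw [ChainComplex.next_nat_zero, (koszulComplex D hD).shape 0 0 (by simp)]
      rfl
    | succ q =>
      rw [ChainComplex.next_nat_succ]
      have h0 : koszulD D q x₀ = 0 := by
        rw [hx₀, koszulD_ofTotal, ← complStar_extOp, hdz₀]
        exact funext fun I => zsmul_zero _
      exact (koszulComplex_d_apply D hD q _).trans h0
  have key1 : ∀ y : Forms M n (q + 1), koszulD D q y ≠ x₀ := fun y hy => by
    obtain ⟨y', hy'⟩ := complStar_bijective.2 (toTotal y)
    refine hne y' (complStar_bijective.1 ?_)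
    rw [complStar_extOp, hy', intOp_toTotal, hy, hx₀, toTotal_ofTotal, ← complStar_degPart hpq,
      hz₀]
  have key : ∀ x : Forms M n q, intOp (endAdd D) (toTotal x) = 0 →
      ∃ (c : K) (y : Forms M n (q + 1)), x = c • x₀ + koszulD D q y := fun x hx => by
    obtain ⟨ω, hω, hωp, hdω⟩ := exists_complStar_eq D hpq x hx
    obtain ⟨c, y, hcy⟩ := h ω hωp hdω
    refine ⟨c, ofTotal (q + 1) (complStar y), ?_⟩
    rw [koszulD_ofTotal, ← complStar_extOp, ← ofTotal_toTotal x, ← hω, hcy, complStar_add,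
      complStar_smul]
    rfl
  obtain ⟨e⟩ := nonempty_homology_iso
    ((koszulComplex D hD).sc' (q + 1) q ((ComplexShape.down ℕ).next q)) x₀ key0
    (fun y hy => key1 y ((koszulComplex_d_apply D hD q y).symm.trans hy)) (fun x hx => by
      obtain ⟨c, y, hcy⟩ := key x (intOp_toTotal_eq_zero_of_next D hD x hx)
      exact ⟨c, y, hcy.trans (congrArg (fun t => c • x₀ + t)
        (koszulComplex_d_apply D hD q y).symm)⟩)
  exact ⟨ShortComplex.homologyMapIso
    ((koszulComplex D hD).isoSc' (q + 1) q _ (by simp) rfl) ≪≫ e⟩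

end Complexes

/-! ### Assembly. -/

theorem mainTheorem1 {K : Type*} [Field K] [CharZero K] (n : ℕ)
    (w : Fin n → ℕ) (hw : ∀ i, 0 < w i)
    (f : MvPolynomial (Fin n) K) (hf0 : f ≠ 0)
    (d : ℕ) (hd : 0 < d) (hf : MvPolynomial.IsWeightedHomogeneous w f d)
    (hiso : IsIsolatedSingularity w f) :
    ((∀ i : ℕ, i + 2 ≤ n → i ≠ 1 → Limits.IsZero (deRhamCohomology f i)) ∧
      (n ≠ 2 → Nonempty (deRhamCohomology f 1 ≅ ModuleCat.of K K))) ∧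
    ((∀ i : ℕ, (2 ≤ i ∧ i + 2 ≤ n) ∨ i = n → Limits.IsZero (deRhamHomology f i)) ∧
      (n ≠ 2 → Nonempty (deRhamHomology f (n - 1) ≅ ModuleCat.of K K))) := by
  have hK : KoszulExact f := hiso.koszul_exact hf0 hd hf
  -- Needed for the truncated `n - 1` to be complementary to degree one.
  have hn : 1 ≤ n := by
    rcases n with _ | n
    · obtain ⟨m, hm⟩ := MvPolynomial.exists_coeff_ne_zero hf0
      have h2 := hf hm
      rw [Subsingleton.elim m 0, map_zero] at h2
      omega
    · omega
  have h0 := eq_zero_of_extOp_partialAdd hf0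
  have hp : ∀ p, 2 ≤ p → p + 2 ≤ n → ∀ z : Finset (Fin n) → LocalCohomologyOne f,
      degPart p z = z → extOp (partialAdd f) z = 0 → ∃ y, z = extOp (partialAdd f) y :=
    fun p hp2 hpn => hK.exists_primitive_quot hf0 hw hf hp2 hpn
  have hlog : degPart 1 (quotForm f (logForm f)) = quotForm f (logForm f) := by
    rw [← quotForm_degPart, degPart_logForm]
  have hne := quot_logForm_ne hf0 hd hf
  refine ⟨⟨fun i hi hi1 => ?_, fun hn2 => ?_⟩, ⟨fun i hi => ?_, fun hn2 => ?_⟩⟩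
  · rcases i with _ | i
    · exact isZero_deRhamComplex_homology_zero _ _ h0
    · exact isZero_deRhamComplex_homology_succ _ _ i (hp (i + 1) (by omega) hi)
  · exact nonempty_deRhamComplex_homology_succ_iso _ _ 0 _ hlog extOp_quot_logForm hne
      (hK.exists_eq_quot_logForm_add hf0 hw hd hf hn2)
  · by_cases hin : i = n
    · exact isZero_koszulComplex_homology _ _ (p := 0) (by omega) fun z hz hdz =>
        ⟨0, by rw [map_zero]; exact h0 z hz hdz⟩
    · exact isZero_koszulComplex_homology _ _ (p := n - i) (by omega)
        (hp (n - i) (by omega) (by omega))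
  · exact nonempty_koszulComplex_homology_iso _ _ (p := 1) (by omega) _ hlog extOp_quot_logForm
      hne (hK.exists_eq_quot_logForm_add hf0 hw hd hf hn2)
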